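/- Let $q\ge 2$ and $d\ge 1$ be integers, $A_0,\dots,A_{q-1}\in\mathbb{C}^{d\times d}$, and let $(f(n))_{n\ge 0}$ be the sequence of $d\times d$ matrices with $f(0)=I$ and $f(qn+r)=A_r f(n)$ for all $n\ge 0$, $0\le r<q$ with $qn+r\ne 0$. Put $F(N)=\sum_{0\le n<N}f(n)$, $C=\sum_{0\le r<q}A_r$, and let $\sigma(C)$ be the set of eigenvalues of $C$. Fix a norm on $\mathbb{C}^d$ and let $\|\cdot\|$ be its induced matrix norm. For $\ell\ge 1$ put $\rho_\ell=\max\{\|A_{r_1}\cdots A_{r_\ell}\|^{1/\ell} : 0\le r_1,\dots,r_\ell<q\}$, and let $\rho=\inf_{\ell\ge 1}\rho_\ell$ be the joint spectral radius. If $\rho=\rho_\ell$ for some $\ell\ge 1$, let $R=\rho$; otherwise let $R>\rho$ be any number such that no eigenvalue $\lambda$ of $C$ satisfies $\rho<|\lambda|\le R$. Let $T$ be any invertible matrix such that $J=TCT^{-1}$ is in Jordan form. Let $D$ be the diagonal matrix whose $j$th diagonal entry is $0$ if $J_{jj}=1$ and $1$ otherwise. Put $C'=T^{-1}DJT$ and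 $K=T^{-1}DT(I-C')^{-1}(I-A_0)$. For $\lambda\in\mathbb{C}$ let $m(\lambda)$ be the size of the largest Jordan block of $C$ with eigenvalue $\lambda$ ($m(\lambda)=0$ if $\lambda\notin\sigma(C)$), and put $$\vartheta=\frac{1}{m(1)!}\,T^{-1}(I-D)T\,(C-I)^{m(1)-1}(I-A_0).$$ Then there are $1$-periodic continuous functions $\Phi_{\lambda k}\colon\mathbb{R}\to\mathbb{C}^{d\times d}$ (for $\lambda\in\sigma(C)$ with $|\lambda|>\rho$ and $0\le k<m(\lambda)$) such that, as $N\to\infty$, $$F(N)=\sum_{\substack{\lambda\in\sigma(C)\\|\lambda|>\rho}}N^{\log_q\lambda}\sum_{0\le k<m(\lambda)}(\log_q N)^k\,\Phi_{\lambda k}(\{\log_q N\})+(\log_q N)^{m(1)}\vartheta+K+O\!\left(N^{\log_q R}(\log N)^{\max\{m(\lambda)\,:\,|\lambda|=R\}}\right).$$ Here $\{x\}=x-\lfloor x\rfloor$, $\log_q\lambda=\log\lambda/\log q$ with the principal value of the complex logarithm, the maximum runs over all $\lambda\in\mathbb{C}$ with $|\lambda|=R$ (so it is $0$ if none of them is an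 eigenvalue of $C$), and for $R=0$ the $O$-term means an error that vanishes for all sufficiently large $N$. The implied constant may depend only on $q$, $d$, $A_0,\dots,A_{q-1}$, $R$ and the fixed choices of the norm and of $T$. If $1\notin\sigma(C)$, then $\vartheta=0$. If $C$ has no eigenvalue $\lambda$ with $|\lambda|\le\rho$, then the $O$-term can be omitted, i.e., the formula holds without it for all $N\ge 1$. For $\lambda\in\sigma(C)$ with $|\lambda|>R$ and $0\le k<m(\lambda)$, the function $\Phi_{\lambda k}$ is Hölder continuous on $\mathbb{R}$ with every positive exponent smaller than $\log_q(|\lambda|/R)$. -/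

import Mathlib

noncomputable section

namespace RegularSeq

open Matrix

/-- The matrix norm induced by a norm `p` on `ℂ^d`: the least `c ≥ 0` such that
`p (M v) ≤ c * p v` for all `v`. -/
def inducedNorm {d : ℕ} (p : Seminorm ℂ (Fin d → ℂ)) (M : Matrix (Fin d) (Fin d) ℂ) : ℝ :=
  sInf {c : ℝ | 0 ≤ c ∧ ∀ v : Fin d → ℂ, p (M *ᵥ v) ≤ c * p v}

/-- `ρ_ℓ`, the maximum of `‖A_{r_1} ⋯ A_{r_ℓ}‖ ^ (1/ℓ)` over all words `r_1 … r_ℓ`. -/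
def rhoLen {q d : ℕ} (p : Seminorm ℂ (Fin d → ℂ)) (A : Fin q → Matrix (Fin d) (Fin d) ℂ)
    (l : ℕ) : ℝ :=
  ⨆ r : Fin l → Fin q,
    (inducedNorm p (List.ofFn fun i => A (r i)).prod) ^ (1 / (l : ℝ))

/-- The joint spectral radius `ρ` of the matrices `A_0, …, A_{q-1}`. -/
def jointSpectralRadius {q d : ℕ} (p : Seminorm ℂ (Fin d → ℂ))
    (A : Fin q → Matrix (Fin d) (Fin d) ℂ) : ℝ :=
  ⨅ l : ℕ+, rhoLen p A l

/-- The finiteness property: the infimum defining `ρ` is attained. -/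
def FinitenessProperty {q d : ℕ} (p : Seminorm ℂ (Fin d → ℂ))
    (A : Fin q → Matrix (Fin d) (Fin d) ℂ) : Prop :=
  ∃ l : ℕ, 0 < l ∧ jointSpectralRadius p A = rhoLen p A l

/-- `C = A_0 + ⋯ + A_{q-1}`. -/
def sumMat {q d : ℕ} (A : Fin q → Matrix (Fin d) (Fin d) ℂ) : Matrix (Fin d) (Fin d) ℂ :=
  ∑ r, A r

/-- The admissible choices of `R`: `R = ρ` if the finiteness property holds; otherwise any
`R > ρ` such that `C` has no eigenvalue `z` with `ρ < |z| ≤ R`. -/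
def IsAdmissibleRadius {q d : ℕ} (p : Seminorm ℂ (Fin d → ℂ))
    (A : Fin q → Matrix (Fin d) (Fin d) ℂ) (R : ℝ) : Prop :=
  (FinitenessProperty p A → R = jointSpectralRadius p A) ∧
  (¬ FinitenessProperty p A → jointSpectralRadius p A < R ∧
    ∀ z ∈ spectrum ℂ (sumMat A), ¬ (jointSpectralRadius p A < ‖z‖ ∧ ‖z‖ ≤ R))

/-- `J` is in Jordan form: it vanishes off the diagonal and the superdiagonal, each
superdiagonal entry is `0` or `1`, and an entry `1` joins equal diagonal entries. -/
def IsJordanForm {d : ℕ} (J : Matrix (Fin d) (Fin d) ℂ) : Prop :=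
  ∀ i j : Fin d,
    (i ≠ j → (i : ℕ) + 1 ≠ j → J i j = 0) ∧
    ((i : ℕ) + 1 = j → J i j = 0 ∨ (J i j = 1 ∧ J i i = J j j))

/-- The `n × n` Jordan block with eigenvalue `z`. -/
def jordanBlock (z : ℂ) (n : ℕ) : Matrix (Fin n) (Fin n) ℂ :=
  Matrix.of fun a b => if a = b then z else if (a : ℕ) + 1 = b then 1 else 0

/-- `m(z)`, the size of the largest Jordan block with eigenvalue `z` of a matrix `J` in Jordan
form, that is, of the largest Jordan block occurring in `J` in the (consecutive) positions
`i, …, i + n - 1`. It is `0` if `z` is not an eigenvalue. -/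
def maxBlock {d : ℕ} (J : Matrix (Fin d) (Fin d) ℂ) (z : ℂ) : ℕ :=
  sSup {n : ℕ | ∃ (i : ℕ) (h : i + n ≤ d),
    J.submatrix (fun a : Fin n => Fin.castLE h (Fin.natAdd i a))
      (fun a : Fin n => Fin.castLE h (Fin.natAdd i a)) = jordanBlock z n}

/-- The diagonal matrix `D` with entry `0` where the diagonal entry of `J` is `1`, and entry `1`
elsewhere. -/
def diagD {d : ℕ} (J : Matrix (Fin d) (Fin d) ℂ) : Matrix (Fin d) (Fin d) ℂ :=
  open Classical in Matrix.diagonal fun j => if J j j = 1 then 0 else 1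

/-- `C' = T⁻¹ D J T`. -/
def matC' {d : ℕ} (T J : Matrix (Fin d) (Fin d) ℂ) : Matrix (Fin d) (Fin d) ℂ :=
  T⁻¹ * diagD J * J * T

/-- `K = T⁻¹ D T (I - C')⁻¹ (I - A_0)`. -/
def constK {d : ℕ} (T J A₀ : Matrix (Fin d) (Fin d) ℂ) : Matrix (Fin d) (Fin d) ℂ :=
  T⁻¹ * diagD J * T * (1 - matC' T J)⁻¹ * (1 - A₀)

/-- `ϑ_m = (1 / m!) T⁻¹ (I - D) T (C - I) ^ (m - 1) (I - A_0)`, where the exponent `m - 1` is an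
integer. -/
def thetaSeq {d : ℕ} (C T J A₀ : Matrix (Fin d) (Fin d) ℂ) (m : ℕ) :
    Matrix (Fin d) (Fin d) ℂ :=
  (1 / (m.factorial : ℂ)) • (T⁻¹ * (1 - diagD J) * T * (C - 1) ^ ((m : ℤ) - 1) * (1 - A₀))

/-- `ϑ = ϑ_{m(1)}`. -/
def theta {d : ℕ} (C T J A₀ : Matrix (Fin d) (Fin d) ℂ) : Matrix (Fin d) (Fin d) ℂ :=
  thetaSeq C T J A₀ (maxBlock J 1)

/-- The finite set of eigenvalues `z` of `C` with `|z| > r`. -/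
def largeEigenvalues {d : ℕ} (C : Matrix (Fin d) (Fin d) ℂ) (r : ℝ) : Finset ℂ :=
  open Classical in (Matrix.finite_spectrum C).toFinset.filter fun z => r < ‖z‖

/-- The main terms of the expansion: the sum over the eigenvalues `z` of `C` with `|z| > r` of
`N ^ (log_q z) * ∑_{k < m(z)} (log_q N) ^ k * Φ_{z k}({log_q N})`,
plus `(log_q N) ^ m(1) * ϑ + K`. -/
def mainTerms {d : ℕ} (q : ℕ) (C T J A₀ : Matrix (Fin d) (Fin d) ℂ) (r : ℝ)
    (Φ : ℂ → ℕ → ℝ → Matrix (Fin d) (Fin d) ℂ) (N : ℕ) : Matrix (Fin d) (Fin d) ℂ :=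
  (∑ z ∈ largeEigenvalues C r, ((N : ℂ) ^ (Complex.log z / (Real.log q : ℂ))) •
    ∑ k ∈ Finset.range (maxBlock J z),
      ((Real.logb q N : ℂ) ^ k) • Φ z k (Int.fract (Real.logb q N)))
  + ((Real.logb q N : ℂ) ^ maxBlock J 1) • theta C T J A₀
  + constK T J A₀

/-- `N ^ (log_q R) * (log N) ^ max {m(z) : |z| = R}`. For `R = 0` the first factor is read
as `0`, so that an error term of this order vanishes for all large `N`. -/
def errorScale {d : ℕ} (q : ℕ) (J : Matrix (Fin d) (Fin d) ℂ) (R : ℝ) (N : ℕ) : ℝ :=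
  open Classical in
  (if R = 0 then 0 else (N : ℝ) ^ Real.logb q R) *
    Real.log N ^ sSup {m : ℕ | ∃ z : ℂ, ‖z‖ = R ∧ m = maxBlock J z}

end RegularSeq

end

/-! Put `w = I - A_0` and `B_r = A_0 + ⋯ + A_{r-1}`. Summing over last digits gives `F(qn+r) = C
F(n) + B_r f(n) + w` for `qn+r ≥ 1`. Products of some fixed length `l` have norm at most `R^l`, so
for `R > 0` the forcing `f(n)` is of order `R^(log_q n)`. The spectral projections `P_z` of `C`
commute with `C` and sum to `1`, so each `P_z F` can be studied alone.

If `|z| > R`, then `C` is invertible on the range of `P_z`, and `C^(-i) P_z F(⌊x q^i⌋) - ∑_{1 ≤ j ≤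
i} C^(-j) P_z w` converges geometrically to a function `H(x)`. Since `B_0 = 0`, `H` equals `P_z F`
at the positive integers, and `H(qx) = C H(x) + P_z w` (`exists_interpolation`). In the variable `t
= log_q x` this is a difference equation. For `z ≠ 1` the fixed point `P_z K` is subtracted; after
multiplication by `z^(-t)` the result is annihilated by `Δ^m(z)`, hence is a polynomial in `t` with
periodic coefficients (`exists_periodic_expansion`). For `z = 1` one more difference is needed, and
the additional top coefficient is the constant `ϑ`. Hölder continuity comes from comparing `H` with
its `i`-th approximation at the scale `q^(-i)` of `|x - y|` (`limit_holder`).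

If `|z| ≤ R`, iterating the recursion bounds `P_z F` up to the explicit terms, with a logarithm for
each step of a Jordan chain when `|z| = R` (`component_isBigO`). If `R = 0`, then `f` has finite
support and `C` is nilpotent, so the error vanishes eventually. -/

namespace RegularSeq

open Finset

/-! ### Local Hölder continuity and periodic extension -/

section Holder

variable {E : Type*} [NormedAddCommGroup E]

/-- Hölder continuity with exponent `α` on every interval `[0, M]`. -/
def HolderLoc (α : ℝ) (g : ℝ → E) : Prop :=
  ∀ M : ℝ, ∃ c, 0 ≤ c ∧ ∀ x ∈ Set.Icc 0 M, ∀ y ∈ Set.Icc 0 M, ‖g x - g y‖ ≤ c * |x - y| ^ α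

theorem HolderLoc.of_le {α : ℝ} {g : ℝ → E}
    (h : ∀ M : ℝ, ∃ c, 0 ≤ c ∧ ∀ x y, 0 ≤ x → x < y → y ≤ M → ‖g y - g x‖ ≤ c * (y - x) ^ α) :
    HolderLoc α g := by
  intro M
  obtain ⟨c, hc, H⟩ := h M
  refine ⟨c, hc, fun x hx y hy => ?_⟩
  rcases lt_trichotomy x y with hxy | hxy | hxy
  · rw [norm_sub_rev, abs_sub_comm, abs_of_pos (sub_pos.2 hxy)]
    exact H x y hx.1 hxy hy.2
  · subst hxy
    simpa using mul_nonneg hc (Real.rpow_nonneg le_rfl α)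
  · rw [abs_of_pos (sub_pos.2 hxy)]
    exact H y x hy.1 hxy hx.2

theorem HolderLoc.const (α : ℝ) (a : E) : HolderLoc α (fun _ => a) := fun M =>
  ⟨0, le_rfl, fun x _ y _ => by simp⟩

theorem HolderLoc.add {α : ℝ} {f g : ℝ → E} (hf : HolderLoc α f) (hg : HolderLoc α g) :
    HolderLoc α (fun x => f x + g x) := by
  intro M
  obtain ⟨a, ha, hf⟩ := hf M
  obtain ⟨b, hb, hg⟩ := hg M
  refine ⟨a + b, by positivity, fun x hx y hy => ?_⟩
  calc ‖f x + g x - (f y + g y)‖ = ‖(f x - f y) + (g x - g y)‖ := by congr 1; abel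
    _ ≤ _ := (norm_add_le _ _).trans (add_le_add (hf x hx y hy) (hg x hx y hy))
    _ = _ := by ring

theorem HolderLoc.bounded {α : ℝ} (hα : 0 < α) {f : ℝ → E} (hf : HolderLoc α f) (M : ℝ) :
    ∃ c, 0 ≤ c ∧ ∀ x ∈ Set.Icc 0 M, ‖f x‖ ≤ c := by
  obtain ⟨a, ha, hf⟩ := hf M
  refine ⟨‖f 0‖ + a * |M| ^ α, by positivity, fun x hx => ?_⟩
  have h0 : (0 : ℝ) ∈ Set.Icc 0 M := ⟨le_rfl, hx.1.trans hx.2⟩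
  have h1 : |x - 0| ^ α ≤ |M| ^ α := by
    apply Real.rpow_le_rpow (abs_nonneg _) _ hα.le
    rw [sub_zero, abs_of_nonneg hx.1, abs_of_nonneg h0.2]
    exact hx.2
  calc ‖f x‖ = ‖f 0 + (f x - f 0)‖ := by congr 1; abel
    _ ≤ ‖f 0‖ + a * |x - 0| ^ α := (norm_add_le _ _).trans (by gcongr; exact hf x hx 0 h0)
    _ ≤ _ := by gcongr

theorem HolderLoc.smul [NormedSpace ℂ E] {α : ℝ} (hα : 0 < α) {φ : ℝ → ℂ} {g : ℝ → E}
    (hφ : HolderLoc α φ) (hg : HolderLoc α g) : HolderLoc α (fun x => φ x • g x) := by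
  intro M
  obtain ⟨a', ha', hφb⟩ := hφ.bounded hα M
  obtain ⟨b', hb', hgb⟩ := hg.bounded hα M
  obtain ⟨a, ha, hφ⟩ := hφ M
  obtain ⟨b, hb, hg⟩ := hg M
  refine ⟨a * b' + a' * b, by positivity, fun x hx y hy => ?_⟩
  calc ‖φ x • g x - φ y • g y‖ = ‖(φ x - φ y) • g x + φ y • (g x - g y)‖ := by
        congr 1; rw [sub_smul, smul_sub]; abel
    _ ≤ ‖φ x - φ y‖ * ‖g x‖ + ‖φ y‖ * ‖g x - g y‖ :=
        (norm_add_le _ _).trans (add_le_add (norm_smul_le _ _) (norm_smul_le _ _))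
    _ ≤ (a * |x - y| ^ α) * b' + a' * (b * |x - y| ^ α) := by
        gcongr
        exacts [hφ x hx y hy, hgb x hx, hφb y hy, hg x hx y hy]
    _ = _ := by ring

/-- Compactness gives a Lipschitz constant, and `α ≤ 1` allows `|x - y|` to be bounded by `|M| ^ (1
- α) * |x - y| ^ α`. -/
theorem HolderLoc.of_contDiff {α : ℝ} (h1 : α ≤ 1) [NormedSpace ℝ E] {φ : ℝ → E}
    (hφ : ContDiff ℝ 1 φ) : HolderLoc α φ := by
  intro M
  obtain ⟨L, hL⟩ := (hφ.locallyLipschitz.locallyLipschitzOn (s := Set.Icc 0 M)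
    ).exists_lipschitzOnWith_of_compact isCompact_Icc
  refine ⟨L * |M| ^ (1 - α), by positivity, fun x hx y hy => ?_⟩
  have h := hL.dist_le_mul x hx y hy
  rw [dist_eq_norm, Real.dist_eq] at h
  rcases eq_or_ne x y with rfl | hxy
  · simpa using by positivity
  refine h.trans ?_
  have hp : 0 < |x - y| := abs_pos.2 (sub_ne_zero.2 hxy)
  have : |x - y| = |x - y| ^ (1 - α) * |x - y| ^ α := by
    rw [← Real.rpow_add hp]; simp
  calc (L : ℝ) * |x - y| = L * (|x - y| ^ (1 - α) * |x - y| ^ α) := by rw [← this]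
    _ ≤ L * (|M| ^ (1 - α) * |x - y| ^ α) := by
        have hM : |x - y| ≤ |M| := by
          rw [abs_of_nonneg (hx.1.trans hx.2), abs_le]
          constructor <;> linarith [hx.1, hx.2, hy.1, hy.2]
        have := Real.rpow_le_rpow hp.le hM (sub_nonneg.2 h1)
        gcongr
    _ = _ := by ring

theorem HolderLoc.neg {α : ℝ} {g : ℝ → E} (hg : HolderLoc α g) : HolderLoc α (fun x => - g x) := by
  intro M
  obtain ⟨b, hb, hg⟩ := hg M
  refine ⟨b, hb, fun x hx y hy => ?_⟩
  rw [← neg_sub', norm_neg]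
  exact hg x hx y hy

theorem HolderLoc.sub {α : ℝ} {f g : ℝ → E} (hf : HolderLoc α f) (hg : HolderLoc α g) :
    HolderLoc α (fun x => f x - g x) := by
  simpa only [sub_eq_add_neg] using hf.add hg.neg

theorem HolderLoc.shift {α : ℝ} {g : ℝ → E} (hg : HolderLoc α g) :
    HolderLoc α (fun x => g (x + 1)) := by
  intro M
  obtain ⟨b, hb, hg⟩ := hg (M + 1)
  refine ⟨b, hb, fun x hx y hy => ?_⟩
  have := hg (x + 1) ⟨by linarith [hx.1], by linarith [hx.2]⟩ (y + 1)
    ⟨by linarith [hy.1], by linarith [hy.2]⟩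
  simpa using this

theorem HolderLoc.fwdDiff_iter {α : ℝ} {g : ℝ → E} (hg : HolderLoc α g) (n : ℕ) :
    HolderLoc α ((fwdDiff 1)^[n] g) := by
  induction n with
  | zero => exact hg
  | succ n ih => rw [Function.iterate_succ_apply']; exact ih.shift.sub ih

/-- A function that is `1`-periodic on `[0, ∞)` and Hölder continuous there on bounded intervals
has a globally Hölder continuous periodic extension. -/
theorem HolderLoc.fract {α : ℝ} (hα : 0 < α) {g : ℝ → E} (hg : HolderLoc α g)
    (hper : ∀ t, 0 ≤ t → g (t + 1) = g t) :
    ∃ c, 0 ≤ c ∧ ∀ x y : ℝ, ‖g (Int.fract x) - g (Int.fract y)‖ ≤ c * |x - y| ^ α := by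
  obtain ⟨c, hc, hg⟩ := hg 2
  refine ⟨c, hc, ?_⟩
  have key : ∀ x y : ℝ, x ≤ y → ‖g (Int.fract x) - g (Int.fract y)‖ ≤ c * |x - y| ^ α := by
    intro x y hxy
    have hx0 := Int.fract_nonneg x
    have hx1 := Int.fract_lt_one x
    have hy0 := Int.fract_nonneg y
    have hy1 := Int.fract_lt_one y
    -- If `y - x ≤ 1`, periodicity replaces `fract y` by `y - ⌊x⌋`, which lies in `[0, 2]` at
    -- distance exactly `y - x` from `fract x`. Otherwise the fractional parts are closer together
    -- than `x` and `y`.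
    rcases le_or_gt (y - x) 1 with h1 | h1
    · have hfx : Int.fract x = x - ⌊x⌋ := rfl
      have hfy : Int.fract y = y - ⌊y⌋ := rfl
      have h2 : g (Int.fract y) = g (y - ⌊x⌋) := by
        have hle : ⌊x⌋ ≤ ⌊y⌋ := Int.floor_le_floor hxy
        have hle2 : ⌊y⌋ ≤ ⌊x⌋ + 1 := by
          have : (⌊y⌋ : ℝ) < (⌊x⌋ + 2 : ℤ) := by push_cast; linarith
          have := Int.cast_lt.1 this
          omega
        rcases hle.eq_or_lt with h | h
        · rw [hfy, h]
        · have h3 : ⌊y⌋ = ⌊x⌋ + 1 := by omega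
          rw [← hper _ hy0]
          congr 1
          rw [hfy, h3]; push_cast; ring
      rw [h2]
      have := hg (Int.fract x) ⟨hx0, by linarith⟩ (y - ⌊x⌋) ⟨by linarith, by linarith⟩
      convert this using 3
      rw [hfx]; ring_nf
    · have := hg (Int.fract x) ⟨hx0, by linarith⟩ (Int.fract y) ⟨hy0, by linarith⟩
      have h3 : |Int.fract x - Int.fract y| ≤ |x - y| := by
        rw [abs_sub_comm x y, abs_of_pos (by linarith : 0 < y - x)]
        refine le_trans ?_ h1.le
        rw [abs_le]; constructor <;> linarith
      exact this.trans
        (mul_le_mul_of_nonneg_left (Real.rpow_le_rpow (abs_nonneg _) h3 hα.le) hc)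
  intro x y
  rcases le_total x y with h | h
  · exact key x y h
  · rw [norm_sub_rev, abs_sub_comm]; exact key y x h

end Holder

/-! ### Forward differences and polynomials with periodic coefficients -/

section Difference

variable {E : Type*} [AddCommGroup E] [Module ℂ E]

/-- A periodic factor behaves like a constant under the difference operator. -/
theorem fwdDiff_iter_smul_of_periodic {ψ : ℝ → E} (hψ : ∀ t, 0 ≤ t → ψ (t + 1) = ψ t) (n : ℕ)
    (φ : ℝ → ℂ) (t : ℝ) (ht : 0 ≤ t) :
    (fwdDiff 1)^[n] (fun t => φ t • ψ t) t = (fwdDiff 1)^[n] φ t • ψ t := by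
  induction n generalizing t with
  | zero => rfl
  | succ n ih =>
    rw [Function.iterate_succ_apply', Function.iterate_succ_apply', fwdDiff, fwdDiff, ih t ht,
      ih (t + 1) (by linarith), hψ t ht, sub_smul]

theorem fwdDiff_iter_ofReal_pow (n : ℕ) (t : ℝ) :
    (fwdDiff 1)^[n] (fun t : ℝ => (t : ℂ) ^ n) t = (n.factorial : ℂ) := by
  have key : ∀ k (t : ℝ), (fwdDiff 1)^[k] (fun t : ℝ => (t : ℂ) ^ n) t =
      (fwdDiff 1)^[k] (fun t : ℂ => t ^ n) (t : ℂ) := by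
    intro k
    induction k with
    | zero => intro t; rfl
    | succ k ih =>
      intro t
      rw [Function.iterate_succ_apply', Function.iterate_succ_apply', fwdDiff, fwdDiff, ih, ih]
      push_cast
      rfl
  rw [key, fwdDiff_iter_eq_factorial]
  rfl

end Difference

/-- A function annihilated by the `m`-th power of the difference operator is a polynomial of
degree less than `m` with periodic coefficients, which inherit its Hölder continuity. -/
theorem exists_periodic_expansion {E : Type*} [NormedAddCommGroup E] [NormedSpace ℂ E] (m : ℕ)
    (g : ℝ → E) (hg : ∀ t, 0 ≤ t → (fwdDiff 1)^[m] g t = 0) :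
    ∃ Φ : ℕ → ℝ → E, (∀ k t, 0 ≤ t → Φ k (t + 1) = Φ k t) ∧
      (∀ t, 0 ≤ t → g t = ∑ k ∈ range m, ((t : ℂ) ^ k) • Φ k t) ∧
      (∀ k α, 0 < α → α ≤ 1 → HolderLoc α g → HolderLoc α (Φ k)) ∧
      (∀ n, m = n + 1 → Φ n = fun t => (1 / (n.factorial : ℂ)) • (fwdDiff 1)^[n] g t) := by
  induction m generalizing g with
  | zero =>
    refine ⟨fun _ _ => 0, fun _ _ _ => rfl, fun t ht => by simpa using hg t ht,
      fun _ _ _ _ _ => HolderLoc.const _ _, fun n hn => by omega⟩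
  | succ m ih =>
    -- The leading coefficient is forced to be `Δ^m g / m!`, which is periodic because `Δ^(m+1) g =
    -- 0`. Since `Δ^m t^m = m!`, subtracting `t^m ψ` leaves a function annihilated by `Δ^m`. The
    -- explicit form of this coefficient later identifies `ϑ`.
    set ψ : ℝ → E := fun t => (1 / (m.factorial : ℂ)) • (fwdDiff 1)^[m] g t with hψ
    have hper : ∀ t, 0 ≤ t → ψ (t + 1) = ψ t := by
      intro t ht
      have := hg t ht
      rw [Function.iterate_succ_apply', fwdDiff, sub_eq_zero] at this
      simp only [hψ, this]
    have hf : (m.factorial : ℂ) ≠ 0 := by exact_mod_cast m.factorial_ne_zero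
    have hψH : ∀ α, 0 < α → HolderLoc α g → HolderLoc α ψ := fun α hα h =>
      (HolderLoc.const α (1 / (m.factorial : ℂ))).smul hα (h.fwdDiff_iter m)
    obtain ⟨Φ, h1, h2, h3, -⟩ := ih (fun t => g t - ((t : ℂ) ^ m) • ψ t) (by
      intro t ht
      have : (fun t : ℝ => g t - ((t : ℂ) ^ m) • ψ t) =
          g + (-1 : ℤ) • (fun t : ℝ => ((t : ℂ) ^ m) • ψ t) := by
        ext t; simp [sub_eq_add_neg]
      rw [this, fwdDiff_iter_add, fwdDiff_iter_const_smul, Pi.add_apply, Pi.smul_apply,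
        fwdDiff_iter_smul_of_periodic hper m _ t ht, fwdDiff_iter_ofReal_pow]
      simp only [hψ]
      rw [smul_smul, mul_one_div_cancel hf]
      simp)
    refine ⟨fun k => if k = m then ψ else Φ k, ?_, ?_, ?_, ?_⟩
    · intro k t ht
      by_cases h : k = m
      · simpa [h] using hper t ht
      · simpa [h] using h1 k t ht
    · intro t ht
      rw [sum_range_succ, ← sub_eq_iff_eq_add]
      simp only [if_true]
      rw [h2 t ht]
      refine sum_congr rfl fun k hk => ?_
      rw [if_neg (mem_range.1 hk).ne]
    · intro k α hα hα1 h
      by_cases hk : k = m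
      · simpa [hk] using hψH α hα h
      · simp only [hk, if_false]
        refine h3 k α hα hα1 (h.sub (HolderLoc.smul hα (HolderLoc.of_contDiff hα1 ?_) (hψH α hα h)))
        exact Complex.ofRealCLM.contDiff.pow m
    · intro n hn
      obtain rfl : m = n := by omega
      simp [hψ]

end RegularSeq

namespace RegularSeq

open Finset Filter Topology

/-! ### Positive and negative powers on a generalized eigenspace -/

section Growth

variable {𝔸 : Type*} [NormedRing 𝔸] [NormedAlgebra ℂ 𝔸]

/-- If `(C - z) ^ m * P = 0`, then `C ^ j * P` grows at most like `s ^ j` for each `s > |z|`. -/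
theorem exists_norm_pow_mul_le (C : 𝔸) (z : ℂ) (m : ℕ) (P : 𝔸)
    (h : (C - algebraMap ℂ 𝔸 z) ^ m * P = 0) {s : ℝ} (hs : ‖z‖ < s) :
    ∃ c, 0 ≤ c ∧ ∀ j : ℕ, ‖C ^ j * P‖ ≤ c * s ^ j := by
  have hs0 : 0 < s := (norm_nonneg z).trans_lt hs
  induction m generalizing P with
  | zero =>
    have : P = 0 := by simpa using h
    exact ⟨0, le_rfl, fun j => by simp [this]⟩
  | succ m ih =>
    obtain ⟨c, hc, H⟩ := ih ((C - algebraMap ℂ 𝔸 z) * P) (by rw [← mul_assoc, ← pow_succ, h])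
    have hd : 0 < s - ‖z‖ := sub_pos.2 hs
    -- The second entry gives `‖z‖ * K + c ≤ K * s`, which closes the induction on `j`.
    set K := max ‖P‖ (c / (s - ‖z‖)) with hK
    have hK0 : 0 ≤ K := (norm_nonneg P).trans (le_max_left _ _)
    have hKc : c ≤ K * (s - ‖z‖) := (div_le_iff₀ hd).1 (le_max_right _ _)
    refine ⟨K, hK0, fun j => ?_⟩
    induction j with
    | zero =>
      rw [pow_zero, one_mul, pow_zero, mul_one]
      exact le_max_left _ _
    | succ j ihj =>
      have e : C ^ (j + 1) * P = z • (C ^ j * P) + C ^ j * ((C - algebraMap ℂ 𝔸 z) * P) := by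
        rw [pow_succ, sub_mul, ← Algebra.smul_def, mul_sub, mul_smul_comm, mul_assoc]
        abel
      rw [e]
      calc _ ≤ ‖z‖ * ‖C ^ j * P‖ + ‖C ^ j * ((C - algebraMap ℂ 𝔸 z) * P)‖ :=
            (norm_add_le _ _).trans (by gcongr; exact norm_smul_le _ _)
        _ ≤ ‖z‖ * (K * s ^ j) + c * s ^ j := by gcongr; exact H j
        _ ≤ ‖z‖ * (K * s ^ j) + (K * (s - ‖z‖)) * s ^ j := by gcongr
        _ = K * s ^ (j + 1) := by ring

/-- The negative powers of `C` on the generalized eigenspace with projection `P` of an eigenvalue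
`z ≠ 0`. -/
theorem exists_negative_powers (C : 𝔸) {z : ℂ} (hz : z ≠ 0) (m : ℕ) (P : 𝔸)
    (hCP : Commute C P) (hPP : P * P = P) (h : (C - algebraMap ℂ 𝔸 z) ^ m * P = 0) :
    ∃ U : ℕ → 𝔸, U 0 = P ∧ (∀ i, U (i + 1) * C = U i) ∧ (∀ i, C * U (i + 1) = U i) ∧
      (∀ i, P * U i = U i) ∧
      ∀ s, 0 < s → s < ‖z‖ → ∃ c, 0 ≤ c ∧ ∀ i, ‖U i‖ ≤ c * s⁻¹ ^ i := by
  -- On the range of `P`, `z⁻¹ C` is `1 + n` with `n` nilpotent. So `u = 1 + n` is a unit of the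
  -- whole algebra, and `V = z⁻¹ u⁻¹` inverts `C` on that range; the witness is `U i = V ^ i * P`.
  set n : 𝔸 := (z⁻¹ • C - 1) * P with hn
  have e0 : z⁻¹ • C - 1 = z⁻¹ • (C - algebraMap ℂ 𝔸 z) := by
    rw [smul_sub, Algebra.algebraMap_eq_smul_one, smul_smul, inv_mul_cancel₀ hz, one_smul]
  have hc1 : Commute (z⁻¹ • C - 1) P := (hCP.smul_left _).sub_left (Commute.one_left _)
  have hPpow : ∀ k, P ^ k * P = P := by
    intro k
    induction k with
    | zero => simp
    | succ k ih => rw [pow_succ, mul_assoc, hPP, ih]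
  have hnm : n ^ m * P = 0 := by
    rw [hn, hc1.mul_pow, mul_assoc, hPpow, e0, smul_pow, smul_mul_assoc, h, smul_zero]
  have hnP : n * P = n := by rw [hn, mul_assoc, hPP]
  have hnil : IsNilpotent n := by
    refine ⟨m + 1, ?_⟩
    rw [pow_succ, ← hnP, ← mul_assoc, hnP]
    have : Commute n P := hc1.mul_left (Commute.refl P)
    rw [mul_assoc, this.eq, ← mul_assoc, hnm, zero_mul]
  obtain ⟨u, hu⟩ := hnil.isUnit_one_add
  have huC : Commute (u : 𝔸) C := by
    rw [hu]
    refine (Commute.one_left C).add_left ?_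
    exact (((Commute.refl C).smul_left _).sub_left (Commute.one_left _)).mul_left hCP.symm
  have huP : Commute (u : 𝔸) P := by
    rw [hu]
    exact (Commute.one_left P).add_left (hc1.mul_left (Commute.refl P))
  have hun : Commute (u : 𝔸) n := by
    rw [hu]
    exact (Commute.one_left n).add_left (Commute.refl n)
  have huiC := huC.units_inv_left
  have huiP := huP.units_inv_left
  have huin := hun.units_inv_left
  have huPe : (u : 𝔸) * P = z⁻¹ • (C * P) := by
    rw [hu, add_mul, hnP, hn, sub_mul, smul_mul_assoc]; simp
  set V : 𝔸 := z⁻¹ • (↑u⁻¹ : 𝔸) with hV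
  have hVC : Commute V C := huiC.smul_left _
  have hVP : Commute V P := huiP.smul_left _
  have hVCP : V * (C * P) = P := by
    have : C * P = z • ((u : 𝔸) * P) := by rw [huPe, smul_smul, mul_inv_cancel₀ hz, one_smul]
    rw [this, hV, smul_mul_smul_comm, inv_mul_cancel₀ hz, one_smul, Units.inv_mul_cancel_left]
  -- `V - z⁻¹` is a multiple of `u⁻¹ n`, so the growth bound for powers applies to `V` with
  -- eigenvalue `z⁻¹`.
  have hVz : (V - algebraMap ℂ 𝔸 z⁻¹) ^ m * P = 0 := by
    have : V - algebraMap ℂ 𝔸 z⁻¹ = (-z⁻¹) • ((↑u⁻¹ : 𝔸) * n) := by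
      have h1 : n = u - 1 := by rw [hu]; abel
      rw [h1, mul_sub, Units.inv_mul, mul_one, hV, Algebra.algebraMap_eq_smul_one, smul_sub,
        neg_smul, neg_smul]
      abel
    rw [this, smul_pow, huin.mul_pow, smul_mul_assoc, mul_assoc, hnm, mul_zero, smul_zero]
  refine ⟨fun i => V ^ i * P, by simp, fun i => ?_, fun i => ?_, fun i => ?_, fun s hs hsz => ?_⟩
  · rw [mul_assoc, ← hCP.eq, pow_succ, mul_assoc, hVCP]
  · rw [← mul_assoc, ← (hVC.pow_left _).eq, mul_assoc, pow_succ, mul_assoc, hVCP]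
  · rw [← mul_assoc, ← (hVP.pow_left _).eq, mul_assoc, hPP]
  · refine exists_norm_pow_mul_le V z⁻¹ m P hVz ?_
    rw [norm_inv]
    exact inv_strictAnti₀ hs hsz

end Growth

/-- The data of a summatory function: `F` has difference sequence `f`, satisfies the recursion
`F n = C * F (n / q) + g n + w`, and `f`, `g` have growth rate `R`. -/
structure IsRegularSum {𝔸 : Type*} [NormedRing 𝔸] (q : ℕ) (C w : 𝔸) (f F g : ℕ → 𝔸) (R : ℝ) :
    Prop where
  step : ∀ n, F (n + 1) = F n + f n
  recursion : ∀ n, 1 ≤ n → F n = C * F (n / q) + g n + w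
  correction_mul : ∀ n, g (q * n) = 0
  bound : ∃ c, 0 ≤ c ∧ ∀ n, ‖f n‖ ≤ c * R ^ Nat.log q n
  correction_bound : ∃ c, 0 ≤ c ∧ ∀ n, ‖g n‖ ≤ c * R ^ Nat.log q (n / q)

/-! ### Interpolation of the summatory function by a limit -/

section Limit

variable {𝔸 : Type*} [NormedRing 𝔸] {q : ℕ} {C w : 𝔸} {f F g : ℕ → 𝔸} {R : ℝ}
  {U : ℕ → 𝔸}

/-- The approximations to the fluctuation. -/
noncomputable def approx (q : ℕ) (U F : ℕ → 𝔸) (w : 𝔸) (i : ℕ) (x : ℝ) : 𝔸 :=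
  U i * F ⌊x * (q : ℝ) ^ i⌋₊ - ∑ j ∈ range i, U (j + 1) * w

theorem floor_mul_pow_succ_div (hq : 2 ≤ q) (x : ℝ) (i : ℕ) :
    ⌊x * (q : ℝ) ^ (i + 1)⌋₊ / q = ⌊x * (q : ℝ) ^ i⌋₊ := by
  rw [← Nat.floor_div_natCast]
  congr 1
  have : (q : ℝ) ≠ 0 := by positivity
  rw [pow_succ, ← mul_assoc, mul_div_cancel_right₀ _ this]

theorem pow_le_floor (hq : 2 ≤ q) {x : ℝ} (hx : 1 ≤ x) (i : ℕ) :
    q ^ i ≤ ⌊x * (q : ℝ) ^ i⌋₊ := by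
  refine Nat.le_floor ?_
  push_cast
  exact le_mul_of_one_le_left (by positivity) hx

theorem floor_le_pow (hq : 2 ≤ q) {x : ℝ} {M : ℕ} (hxM : x ≤ (q : ℝ) ^ M) (i : ℕ) :
    ⌊x * (q : ℝ) ^ i⌋₊ ≤ q ^ (i + M) := by
  refine Nat.floor_le_of_le ?_
  push_cast
  rw [pow_add, mul_comm]
  gcongr

/-- The factor `max 1 R` covers `R < 1` and `R ≥ 1` together. -/
theorem pow_le_pow_mul_max_pow (hR : 0 < R) {i L M : ℕ} (h1 : i ≤ L) (h2 : L ≤ i + M) :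
    R ^ L ≤ R ^ i * (max 1 R) ^ M := by
  obtain ⟨j, rfl⟩ := Nat.exists_eq_add_of_le h1
  rw [pow_add]
  gcongr
  calc R ^ j ≤ (max 1 R) ^ j := by gcongr; exact le_max_right _ _
    _ ≤ _ := pow_le_pow_right₀ (le_max_left _ _) (by omega)

theorem pow_log_le (hq : 2 ≤ q) (hR : 0 < R) {i M n : ℕ} (h1 : q ^ i ≤ n) (h2 : n ≤ q ^ (i + M)) :
    R ^ Nat.log q n ≤ R ^ i * (max 1 R) ^ M := by
  have hq1 : 1 < q := hq
  refine pow_le_pow_mul_max_pow hR (Nat.le_log_of_pow_le hq1 h1) ?_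
  calc Nat.log q n ≤ Nat.log q (q ^ (i + M)) := Nat.log_mono_right h2
    _ = _ := Nat.log_pow hq1 _

/-- The quotient of `⌊x q^(i+1)⌋` by `q` is `⌊x q^i⌋`. So the recursion and `U (i + 1) * C = U i`
cancel the terms in `F`, the subtracted sum cancels `w`, and only the correction `g` survives. -/
theorem approx_succ_sub (hq : 2 ≤ q) (h : IsRegularSum q C w f F g R)
    (hUC : ∀ i, U (i + 1) * C = U i) {x : ℝ} (hx : 1 ≤ x) (i : ℕ) :
    approx q U F w (i + 1) x - approx q U F w i x =
      U (i + 1) * g ⌊x * (q : ℝ) ^ (i + 1)⌋₊ := by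
  have h1 : 1 ≤ ⌊x * (q : ℝ) ^ (i + 1)⌋₊ :=
    (Nat.one_le_pow _ _ (by omega)).trans (pow_le_floor hq hx (i + 1))
  rw [approx, approx, h.recursion _ h1, floor_mul_pow_succ_div hq, sum_range_succ, mul_add,
    mul_add, ← mul_assoc, hUC]
  abel

/-- The correction has order `R ^ i` and `U (i + 1)` has order `s⁻¹ ^ i`, uniformly for `x` in `[1,
q ^ M]`. -/
theorem approx_dist_le (hq : 2 ≤ q) (hR : 0 < R) (h : IsRegularSum q C w f F g R)
    (hUC : ∀ i, U (i + 1) * C = U i) {s : ℝ} (hs : 0 < s)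
    (hU : ∃ c, 0 ≤ c ∧ ∀ i, ‖U i‖ ≤ c * s⁻¹ ^ i) (M : ℕ) :
    ∃ K, 0 ≤ K ∧ ∀ x : ℝ, 1 ≤ x → x ≤ (q : ℝ) ^ M → ∀ i,
      dist (approx q U F w i x) (approx q U F w (i + 1) x) ≤ K * (R / s) ^ i := by
  obtain ⟨c, hc, hU⟩ := hU
  obtain ⟨b, hb, hg⟩ := h.correction_bound
  refine ⟨c * s⁻¹ * b * (max 1 R) ^ M, by positivity, fun x hx hxM i => ?_⟩
  rw [dist_comm, dist_eq_norm, approx_succ_sub hq h hUC hx]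
  have h1 := hg ⌊x * (q : ℝ) ^ (i + 1)⌋₊
  rw [floor_mul_pow_succ_div hq] at h1
  have h2 := pow_log_le hq hR (pow_le_floor hq hx i) (floor_le_pow hq hxM i)
  calc _ ≤ ‖U (i + 1)‖ * ‖g ⌊x * (q : ℝ) ^ (i + 1)⌋₊‖ := norm_mul_le _ _
    _ ≤ (c * s⁻¹ ^ (i + 1)) * (b * (R ^ i * (max 1 R) ^ M)) := by
        gcongr
        · exact hU _
        · exact h1.trans (by gcongr)
    _ = _ := by rw [div_eq_mul_inv, mul_pow]; ring

theorem exists_limit [CompleteSpace 𝔸] (hq : 2 ≤ q) (hR : 0 < R)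
    (h : IsRegularSum q C w f F g R)
    (hUC : ∀ i, U (i + 1) * C = U i) {s : ℝ} (hs : R < s)
    (hU : ∃ c, 0 ≤ c ∧ ∀ i, ‖U i‖ ≤ c * s⁻¹ ^ i) :
    ∃ H : ℝ → 𝔸, ∀ x, 1 ≤ x → Tendsto (fun i => approx q U F w i x) atTop (𝓝 (H x)) := by
  have hs0 := hR.trans hs
  have : ∀ x : ℝ, ∃ y, 1 ≤ x → Tendsto (fun i => approx q U F w i x) atTop (𝓝 y) := by
    intro x
    by_cases hx : 1 ≤ x
    · obtain ⟨M, hM⟩ := pow_unbounded_of_one_lt x (by exact_mod_cast hq : (1 : ℝ) < q)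
      obtain ⟨K, -, H⟩ := approx_dist_le hq hR h hUC hs0 hU M
      obtain ⟨y, hy⟩ := cauchySeq_tendsto_of_complete
        (cauchySeq_of_le_geometric _ _ ((div_lt_one hs0).2 hs) (H x hx hM.le))
      exact ⟨y, fun _ => hy⟩
    · exact ⟨0, fun h => absurd h hx⟩
  choose H hH using this
  exact ⟨H, hH⟩

/-- Replacing `x` by `q x` shifts the index by one, and a factor `C` undoes one step of `U`. -/
theorem limit_mul (hq : 2 ≤ q) (hCU : ∀ i, C * U (i + 1) = U i) {H : ℝ → 𝔸}
    (hH : ∀ x, 1 ≤ x → Tendsto (fun i => approx q U F w i x) atTop (𝓝 (H x))) {x : ℝ}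
    (hx : 1 ≤ x) : H (q * x) = C * H x + U 0 * w := by
  have hq1 : (1 : ℝ) ≤ q := by exact_mod_cast (by omega : 1 ≤ q)
  refine tendsto_nhds_unique (hH (q * x) (one_le_mul_of_one_le_of_one_le hq1 hx)) ?_
  refine ((((hH x hx).comp (tendsto_add_atTop_nat 1)).const_mul C).add_const (U 0 * w)).congr ?_
  intro i
  have e : x * (q : ℝ) ^ (i + 1) = q * x * q ^ i := by ring
  simp only [Function.comp, approx]
  rw [mul_sub, ← mul_assoc, hCU, e, mul_sum, sum_range_succ']
  simp only [← mul_assoc, hCU]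
  abel

/-- At an integer the arguments `N q^(i+1)` are multiples of `q`, where `g` vanishes, so the
approximations do not depend on `i`. -/
theorem limit_natCast (hq : 2 ≤ q) (h : IsRegularSum q C w f F g R)
    (hUC : ∀ i, U (i + 1) * C = U i) {H : ℝ → 𝔸}
    (hH : ∀ x, 1 ≤ x → Tendsto (fun i => approx q U F w i x) atTop (𝓝 (H x))) {N : ℕ}
    (hN : 1 ≤ N) : H N = U 0 * F N := by
  refine tendsto_nhds_unique (hH N (by exact_mod_cast hN)) (tendsto_const_nhds.congr fun i => ?_)
  induction i with
  | zero => simp [approx]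
  | succ i ih =>
    rw [ih, ← sub_eq_zero, ← neg_eq_zero, neg_sub,
      approx_succ_sub hq h hUC (by exact_mod_cast hN)]
    have : ⌊(N : ℝ) * (q : ℝ) ^ (i + 1)⌋₊ = q * (N * q ^ i) := by
      rw [← Nat.floor_natCast (R := ℝ) (q * (N * q ^ i))]
      congr 1
      push_cast
      ring
    rw [this, h.correction_mul, mul_zero]

theorem mul_limit {P : 𝔸} (hPU : ∀ i, P * U i = U i) {H : ℝ → 𝔸}
    (hH : ∀ x, 1 ≤ x → Tendsto (fun i => approx q U F w i x) atTop (𝓝 (H x))) {x : ℝ}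
    (hx : 1 ≤ x) : P * H x = H x := by
  refine tendsto_nhds_unique ((hH x hx).const_mul P) ((hH x hx).congr fun i => ?_)
  rw [approx, mul_sub, mul_sum, ← mul_assoc, hPU]
  simp only [← mul_assoc, hPU]

theorem norm_sub_le_of_step (h : ∀ n, F (n + 1) = F n + f n) {a b : ℕ} (hab : a ≤ b) {c : ℝ}
    (hc : ∀ n, a ≤ n → n < b → ‖f n‖ ≤ c) : ‖F b - F a‖ ≤ (b - a : ℕ) * c := by
  induction b, hab using Nat.le_induction with
  | base => simp
  | succ b hab ih =>
    have e : F (b + 1) - F a = (F b - F a) + f b := by rw [h]; abel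
    rw [e, Nat.succ_sub hab]
    push_cast
    refine (norm_add_le _ _).trans ?_
    rw [add_mul, one_mul]
    exact add_le_add (ih fun n h1 h2 => hc n h1 (by omega)) (hc b hab (by omega))

/-- Choose `i` so that `q^(-i)` is comparable to `y - x`. Both limits are within `O((R / s) ^ i)` of
their `i`-th approximations. These differ by `U i` applied to boundedly many values of `f`, again
`O((R / s) ^ i)`. The condition `R q^α ≤ s` turns this into `O(q^(-iα))`. -/
theorem limit_holder (hq : 2 ≤ q) (hR : 0 < R) (h : IsRegularSum q C w f F g R)
    (hUC : ∀ i, U (i + 1) * C = U i) {s : ℝ} (hs : R < s)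
    (hU : ∃ c, 0 ≤ c ∧ ∀ i, ‖U i‖ ≤ c * s⁻¹ ^ i) {H : ℝ → 𝔸}
    (hH : ∀ x, 1 ≤ x → Tendsto (fun i => approx q U F w i x) atTop (𝓝 (H x)))
    {α : ℝ} (hα : 0 < α) (hαs : R * (q : ℝ) ^ α ≤ s) (M : ℕ) :
    ∃ c, 0 ≤ c ∧ ∀ x y : ℝ, 1 ≤ x → x < y → y ≤ (q : ℝ) ^ M → ‖H y - H x‖ ≤ c * (y - x) ^ α := by
  have hs0 := hR.trans hs
  have hμ : R / s < 1 := (div_lt_one hs0).2 hs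
  obtain ⟨K, hK, hKd⟩ := approx_dist_le hq hR h hUC hs0 hU M
  obtain ⟨c, hc, hU⟩ := hU
  obtain ⟨b, hb, hf⟩ := h.bound
  have hq1 : (1 : ℝ) < q := by exact_mod_cast hq
  have hq0 : (0 : ℝ) < q := by positivity
  set B : ℝ := c * (((q : ℝ) ^ M + 1) * (b * (max 1 R) ^ M)) with hB
  have hB0 : 0 ≤ B := by positivity
  have hden : 0 < 1 - R / s := sub_pos.2 hμ
  set B' : ℝ := K / (1 - R / s) + K / (1 - R / s) + B with hB'
  have hB'0 : 0 ≤ B' := by positivity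
  refine ⟨B' * ((q : ℝ) / (q : ℝ) ^ M) ^ α, by positivity, fun x y hx hxy hy => ?_⟩
  have hyx : 0 < y - x := sub_pos.2 hxy
  have hx0 : 0 < x := by linarith
  have hy0 : 0 < y := hx0.trans hxy
  -- Here `q^(-(i+1)) < (y - x) / q^M ≤ q^(-i)`. The upper bound limits the number of summands
  -- between the two floors to `q^M + 1`; the lower one gives the Hölder rate.
  obtain ⟨i, hi1, hi2⟩ := exists_nat_pow_near_of_lt_one (x := (y - x) / (q : ℝ) ^ M)
    (y := 1 / (q : ℝ)) (by positivity) ((div_le_one (by positivity)).2 (by linarith))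
    (by positivity) ((div_lt_one hq0).2 hq1)
  have hqM : (0 : ℝ) < (q : ℝ) ^ M := by positivity
  have hlen : (y - x) * (q : ℝ) ^ i ≤ (q : ℝ) ^ M := by
    rw [div_le_iff₀ hqM, one_div, inv_pow, inv_mul_eq_div, le_div_iff₀ (by positivity)] at hi2
    exact hi2
  have dH : ∀ z : ℝ, 1 ≤ z → z ≤ (q : ℝ) ^ M →
      ‖approx q U F w i z - H z‖ ≤ K / (1 - R / s) * (R / s) ^ i := by
    intro z hz hzM
    have := dist_le_of_le_geometric_of_tendsto _ _ hμ (hKd z hz hzM) (hH z hz) i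
    rw [dist_eq_norm] at this
    refine this.trans (le_of_eq ?_)
    ring
  have dA : ‖approx q U F w i y - approx q U F w i x‖ ≤ B * (R / s) ^ i := by
    have e : approx q U F w i y - approx q U F w i x =
        U i * (F ⌊y * (q : ℝ) ^ i⌋₊ - F ⌊x * (q : ℝ) ^ i⌋₊) := by
      rw [approx, approx, mul_sub]; abel
    have hle : ⌊x * (q : ℝ) ^ i⌋₊ ≤ ⌊y * (q : ℝ) ^ i⌋₊ := by
      apply Nat.floor_mono; gcongr
    have h1 := norm_sub_le_of_step h.step hle (c := b * (R ^ i * (max 1 R) ^ M)) (by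
      intro n hn1 hn2
      refine (hf n).trans ?_
      have := pow_log_le hq hR ((pow_le_floor hq hx i).trans hn1)
        (hn2.le.trans (floor_le_pow hq hy i))
      gcongr)
    have h2 : ((⌊y * (q : ℝ) ^ i⌋₊ - ⌊x * (q : ℝ) ^ i⌋₊ : ℕ) : ℝ) ≤ (q : ℝ) ^ M + 1 := by
      rw [Nat.cast_sub hle]
      have h3 := Nat.floor_le (by positivity : 0 ≤ y * (q : ℝ) ^ i)
      have h4 := Nat.lt_floor_add_one (x * (q : ℝ) ^ i)
      linarith
    rw [e]
    calc _ ≤ ‖U i‖ * ‖F ⌊y * (q : ℝ) ^ i⌋₊ - F ⌊x * (q : ℝ) ^ i⌋₊‖ := norm_mul_le _ _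
      _ ≤ (c * s⁻¹ ^ i) * (((q : ℝ) ^ M + 1) * (b * (R ^ i * (max 1 R) ^ M))) := by
          gcongr
          · exact hU i
          · exact h1.trans (by gcongr)
      _ = _ := by rw [hB, div_eq_mul_inv, mul_pow]; ring
  have total : ‖H y - H x‖ ≤ B' * (R / s) ^ i := by
    have e : H y - H x = -(approx q U F w i y - H y) + (approx q U F w i x - H x) +
        (approx q U F w i y - approx q U F w i x) := by abel
    rw [e]
    calc _ ≤ ‖-(approx q U F w i y - H y)‖ + ‖approx q U F w i x - H x‖ +
          ‖approx q U F w i y - approx q U F w i x‖ := norm_add₃_le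
      _ ≤ _ := by
          rw [norm_neg, hB', add_mul, add_mul]
          exact add_le_add (add_le_add (dH y (hx.trans hxy.le) hy) (dH x hx (hxy.le.trans hy))) dA
  have hrate : (R / s) ^ i ≤ ((q : ℝ) / (q : ℝ) ^ M) ^ α * (y - x) ^ α := by
    have h1 : R / s ≤ (1 / (q : ℝ)) ^ α := by
      rw [Real.div_rpow zero_le_one hq0.le, Real.one_rpow, div_le_div_iff₀ hs0 (by positivity)]
      linarith
    calc (R / s) ^ i ≤ ((1 / (q : ℝ)) ^ α) ^ i := by gcongr
      _ = ((1 / (q : ℝ)) ^ i) ^ α := by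
          rw [← Real.rpow_natCast, ← Real.rpow_mul (by positivity), mul_comm α,
            Real.rpow_mul (by positivity), Real.rpow_natCast]
      _ ≤ ((q : ℝ) / (q : ℝ) ^ M * (y - x)) ^ α := by
          apply Real.rpow_le_rpow (by positivity) _ hα.le
          rw [pow_succ] at hi1
          calc (1 / (q : ℝ)) ^ i = q * ((1 / (q : ℝ)) ^ i * (1 / q)) := by field_simp
            _ ≤ q * ((y - x) / (q : ℝ) ^ M) := by gcongr
            _ = _ := by ring
      _ = _ := Real.mul_rpow (by positivity) hyx.le
  calc ‖H y - H x‖ ≤ B' * (R / s) ^ i := total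
    _ ≤ B' * (((q : ℝ) / (q : ℝ) ^ M) ^ α * (y - x) ^ α) := by gcongr
    _ = _ := by ring

/-- In the logarithmic scale the limit is locally Hölder continuous. -/
theorem limit_holderLoc (hq : 2 ≤ q) (hR : 0 < R) (h : IsRegularSum q C w f F g R)
    (hUC : ∀ i, U (i + 1) * C = U i) {s : ℝ} (hs : R < s)
    (hU : ∃ c, 0 ≤ c ∧ ∀ i, ‖U i‖ ≤ c * s⁻¹ ^ i) {H : ℝ → 𝔸}
    (hH : ∀ x, 1 ≤ x → Tendsto (fun i => approx q U F w i x) atTop (𝓝 (H x)))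
    {α : ℝ} (hα : 0 < α) (hαs : R * (q : ℝ) ^ α ≤ s) :
    HolderLoc α (fun t => H ((q : ℝ) ^ t)) := by
  have hq1 : (1 : ℝ) < q := by exact_mod_cast hq
  have hq0 : (0 : ℝ) < q := by positivity
  refine HolderLoc.of_le fun M => ?_
  obtain ⟨M', hM'⟩ := exists_nat_ge M
  obtain ⟨c, hc, Hc⟩ := limit_holder hq hR h hUC hs hU hH hα hαs M'
  have hcd : ContDiff ℝ 1 (fun t : ℝ => (q : ℝ) ^ t) :=
    contDiff_const.rpow contDiff_id fun _ => hq0.ne'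
  obtain ⟨L, hL, HL⟩ := HolderLoc.of_contDiff (α := 1) le_rfl hcd M
  refine ⟨c * L ^ α, by positivity, fun x y hx hxy hy => ?_⟩
  have h1 : (q : ℝ) ^ x < (q : ℝ) ^ y := Real.rpow_lt_rpow_of_exponent_lt hq1 hxy
  have h2 : (1 : ℝ) ≤ (q : ℝ) ^ x := Real.one_le_rpow hq1.le hx
  have h3 : (q : ℝ) ^ y ≤ (q : ℝ) ^ M' := by
    rw [← Real.rpow_natCast]
    exact Real.rpow_le_rpow_of_exponent_le hq1.le (hy.trans hM')
  have h4 := HL y ⟨hx.trans hxy.le, hy⟩ x ⟨hx, hxy.le.trans hy⟩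
  rw [Real.rpow_one, Real.norm_eq_abs, abs_of_pos (sub_pos.2 h1), abs_of_pos (sub_pos.2 hxy)] at h4
  calc _ ≤ c * ((q : ℝ) ^ y - (q : ℝ) ^ x) ^ α := Hc _ _ h2 h1 h3
    _ ≤ c * (L * (y - x)) ^ α := by
        have := sub_pos.2 h1
        gcongr
    _ = _ := by rw [Real.mul_rpow hL (sub_pos.2 hxy).le, mul_assoc]

end Limit

end RegularSeq

namespace RegularSeq

open Finset Filter Topology

/-! ### Exact expansions for eigenvalues of modulus greater than `R` -/

section Large

variable {𝔸 : Type*} [NormedRing 𝔸] {q : ℕ} {C w : 𝔸}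
  {f F g : ℕ → 𝔸} {R : ℝ}

/-- A difference kills the constant `v`, so each difference after the first only multiplies by `X`.
-/
theorem fwdDiff_iter_of_affine {X v : 𝔸} {h : ℝ → 𝔸}
    (hh : ∀ t, 0 ≤ t → fwdDiff 1 h t = X * h t + v) (n : ℕ) (t : ℝ) (ht : 0 ≤ t) :
    (fwdDiff 1)^[n + 1] h t = X ^ (n + 1) * h t + X ^ n * v := by
  induction n generalizing t with
  | zero => simpa using hh t ht
  | succ n ih =>
    have := hh t ht
    rw [fwdDiff, sub_eq_iff_eq_add] at this
    rw [Function.iterate_succ_apply', fwdDiff, ih t ht, ih (t + 1) (by linarith), this,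
      pow_succ X (n + 1), pow_succ X n]
    noncomm_ring

/-- Keeps all relevant exponents below `1`, so that the smooth factors `t^k` and `z^(-t)` do not
spoil Hölder continuity. -/
theorem lt_one_of_mul_rpow_lt (hq : 2 ≤ q) (hR : 0 < R) {r α : ℝ} (hr : r ≤ q * R)
    (h : R * (q : ℝ) ^ α < r) : α < 1 := by
  have hq1 : (1 : ℝ) < q := by exact_mod_cast hq
  have : R * (q : ℝ) ^ α < R * (q : ℝ) ^ (1 : ℝ) := by
    rw [Real.rpow_one]; linarith
  exact (Real.rpow_lt_rpow_left_iff hq1).1 (lt_of_mul_lt_mul_left this hR.le)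

/-- A sequence of fluctuations: continuous `1`-periodic functions, Hölder continuous with each
exponent `α > 0` with `R * q ^ α < r`. -/
structure IsFluctuation (q : ℕ) (R r : ℝ) (Φ : ℕ → ℝ → 𝔸) : Prop where
  periodic : ∀ k, Function.Periodic (Φ k) 1
  holder : ∀ (k : ℕ) (α : ℝ), 0 < α → R * (q : ℝ) ^ α < r →
    ∃ c, 0 ≤ c ∧ ∀ x y : ℝ, ‖Φ k x - Φ k y‖ ≤ c * |x - y| ^ α

theorem IsFluctuation.of_fract (hq : 2 ≤ q) (hR : 0 < R) {r : ℝ} (hr : r ≤ q * R)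
    {Φ : ℕ → ℝ → 𝔸} (hper : ∀ k t, 0 ≤ t → Φ k (t + 1) = Φ k t)
    (hΦ : ∀ (k : ℕ) (α : ℝ), 0 < α → α ≤ 1 → R * (q : ℝ) ^ α < r → HolderLoc α (Φ k)) :
    IsFluctuation q R r (fun k t => Φ k (Int.fract t)) where
  periodic k t := by simp
  holder k α hα h := (hΦ k α hα (lt_one_of_mul_rpow_lt hq hR hr h).le h).fract hα (hper k)

variable [NormedAlgebra ℂ 𝔸]

/-- The component of `F` in a generalized eigenspace with `|z| > R` extends to a Hölder
continuous function on the logarithmic scale that satisfies an affine functional equation. -/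
theorem exists_interpolation [CompleteSpace 𝔸] (hq : 2 ≤ q) (hR : 0 < R)
    (h : IsRegularSum q C w f F g R) {z : ℂ} (hz : R < ‖z‖) (m : ℕ) {P : 𝔸}
    (hCP : Commute C P) (hPP : P * P = P) (hm : (C - algebraMap ℂ 𝔸 z) ^ m * P = 0) :
    ∃ H : ℝ → 𝔸, (∀ t, 0 ≤ t → H (t + 1) = C * H t + P * w) ∧
      (∀ N : ℕ, 1 ≤ N → H (Real.logb q N) = P * F N) ∧ (∀ t, 0 ≤ t → P * H t = H t) ∧
      ∀ α, 0 < α → R * (q : ℝ) ^ α < ‖z‖ → HolderLoc α H := by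
  have hz0 : z ≠ 0 := norm_pos_iff.1 (hR.trans hz)
  have hq1 : (1 : ℝ) < q := by exact_mod_cast hq
  have hq0 : (0 : ℝ) < q := by positivity
  obtain ⟨U, hU0, hUC, hCU, hPU, hU⟩ := exists_negative_powers C hz0 m P hCP hPP hm
  obtain ⟨s, hRs, hsz⟩ := exists_between hz
  obtain ⟨H, hH⟩ := exists_limit hq hR h hUC hRs (hU s (hR.trans hRs) hsz)
  have hpow : ∀ t : ℝ, 0 ≤ t → (1 : ℝ) ≤ (q : ℝ) ^ t := fun t ht => Real.one_le_rpow hq1.le ht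
  refine ⟨fun t => H ((q : ℝ) ^ t), fun t ht => ?_, fun N hN => ?_, fun t ht => ?_,
    fun α hα hαz => ?_⟩
  · have := limit_mul hq hCU hH (hpow t ht)
    rw [hU0] at this
    simp only
    rw [← this, Real.rpow_add hq0, Real.rpow_one, mul_comm]
  · have hN0 : (0 : ℝ) < N := by exact_mod_cast hN
    simp only
    rw [Real.rpow_logb hq0 hq1.ne' hN0, limit_natCast hq h hUC hH hN, hU0]
  · exact mul_limit hPU hH (hpow t ht)
  -- The rate `s'` may depend on `α`, because `U` and the limit `H` are already fixed and do not
  -- involve it.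
  · obtain ⟨s', h1, h2⟩ := exists_between hαz
    have h3 : R < s' := by
      refine lt_of_le_of_lt ?_ h1
      exact le_mul_of_one_le_right hR.le (Real.one_le_rpow hq1.le hα.le)
    exact limit_holderLoc hq hR h hUC h3 (hU s' (hR.trans h3) h2) hH hα h1.le

/-- Two fractional parts occur: one from extending the coefficients periodically to `ℝ`, one from
the form of the expansion. -/
theorem apply_fract_eq {E : Type*} {φ : ℝ → E} (hper : ∀ t, 0 ≤ t → φ (t + 1) = φ t) {t : ℝ}
    (ht : 0 ≤ t) : φ (Int.fract (Int.fract t)) = φ t := by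
  have key : ∀ (n : ℕ) (s : ℝ), 0 ≤ s → φ (s + n) = φ s := by
    intro n
    induction n with
    | zero => simp
    | succ n ih =>
      intro s hs
      push_cast
      rw [← add_assoc, hper _ (by positivity), ih s hs]
  rw [Int.fract_fract, ← key ⌊t⌋₊ _ (Int.fract_nonneg t)]
  congr 1
  rw [natCast_floor_eq_intCast_floor ht, Int.fract_add_floor]

/-- The fixed point `κ` makes the equation for `H - κ` homogeneous. Multiplication by `z^(-t)` then
gives `ΔG = (z⁻¹ C - 1) G`, and this operator has vanishing `m`-th power on the range of `P`. -/
theorem exists_expansion_of_ne_one [CompleteSpace 𝔸] (hq : 2 ≤ q) (hR : 0 < R)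
    (h : IsRegularSum q C w f F g R) {z : ℂ} (hz : R < ‖z‖) (hzq : ‖z‖ ≤ q * R) (m : ℕ) {P : 𝔸}
    (hCP : Commute C P) (hPP : P * P = P) (hm : (C - algebraMap ℂ 𝔸 z) ^ m * P = 0)
    {κ : 𝔸} (hPκ : P * κ = κ) (hκ : κ = C * κ + P * w) :
    ∃ Φ : ℕ → ℝ → 𝔸, IsFluctuation q R ‖z‖ Φ ∧ ∀ N : ℕ, 1 ≤ N →
      P * F N = Complex.exp ((Real.logb q N : ℂ) * Complex.log z) •
        (∑ k ∈ range m, ((Real.logb q N : ℂ) ^ k) • Φ k (Int.fract (Real.logb q N))) + κ := by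
  have hz0 : z ≠ 0 := norm_pos_iff.1 (hR.trans hz)
  have hq1 : (1 : ℝ) < q := by exact_mod_cast hq
  obtain ⟨H, hH1, hHN, hPH, hHα⟩ := exists_interpolation hq hR h hz m hCP hPP hm
  set X : 𝔸 := z⁻¹ • C - 1 with hX
  have e0 : X = z⁻¹ • (C - algebraMap ℂ 𝔸 z) := by
    rw [hX, smul_sub, Algebra.algebraMap_eq_smul_one, smul_smul, inv_mul_cancel₀ hz0, one_smul]
  have hXm : X ^ m * P = 0 := by rw [e0, smul_pow, smul_mul_assoc, hm, smul_zero]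
  set G : ℝ → 𝔸 := fun t => Complex.exp (-(t : ℂ) * Complex.log z) • (H t - κ) with hG
  have hΔ : ∀ t, 0 ≤ t → fwdDiff 1 G t = X * G t + 0 := by
    intro t ht
    have h1 : Complex.exp (-((t + 1 : ℝ) : ℂ) * Complex.log z) =
        Complex.exp (-(t : ℂ) * Complex.log z) * z⁻¹ := by
      have : -((t + 1 : ℝ) : ℂ) * Complex.log z =
          -(t : ℂ) * Complex.log z + -Complex.log z := by push_cast; ring
      rw [this, Complex.exp_add, Complex.exp_neg (Complex.log z), Complex.exp_log hz0]
    have h2 : H (t + 1) - κ = C * (H t - κ) := by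
      rw [hH1 t ht, mul_sub]
      nth_rewrite 1 [hκ]
      abel
    simp only [fwdDiff, hG]
    rw [h1, h2, mul_smul, ← smul_sub, add_zero, hX, mul_smul_comm, sub_mul, smul_mul_assoc,
      one_mul]
  have hPG : ∀ t, 0 ≤ t → P * G t = G t := by
    intro t ht
    simp only [hG]
    rw [mul_smul_comm, mul_sub, hPH t ht, hPκ]
  obtain ⟨Φ, hper, hexp, hhol, -⟩ := exists_periodic_expansion m G (by
    intro t ht
    cases m with
    | zero =>
      have : P = 0 := by simpa using hm
      rw [Function.iterate_zero, id, ← hPG t ht, this, zero_mul]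
    | succ n =>
      rw [fwdDiff_iter_of_affine hΔ n t ht, ← hPG t ht, ← mul_assoc, hXm, zero_mul, mul_zero,
        add_zero])
  refine ⟨fun k t => Φ k (Int.fract t), IsFluctuation.of_fract hq hR hzq hper ?_, ?_⟩
  · intro k α hα hα1 hαz
    refine hhol k α hα hα1 (HolderLoc.smul hα (HolderLoc.of_contDiff hα1 ?_)
      ((hHα α hα hαz).sub (HolderLoc.const α κ)))
    have : ContDiff ℝ 1 (fun t : ℝ => (t : ℂ)) := Complex.ofRealCLM.contDiff
    exact (this.neg.mul contDiff_const).cexp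
  · intro N hN
    have ht : 0 ≤ Real.logb q N := Real.logb_nonneg hq1 (by exact_mod_cast hN)
    simp only [apply_fract_eq (hper _) ht]
    rw [← hexp _ ht, ← hHN N hN]
    simp only [hG]
    rw [smul_smul, ← Complex.exp_add, neg_mul, add_neg_cancel, Complex.exp_zero, one_smul]
    abel

/-- Without a fixed point, `ΔH = (C - 1) H + P w` still gives `Δ^(m+2) H = 0`. The coefficient of
`t^(m+1)` is `Δ^(m+1) H / (m+1)!`, where only the constant `(C - 1)^m P w` survives. -/
theorem exists_expansion_one [CompleteSpace 𝔸] (hq : 2 ≤ q) (hR : 0 < R)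
    (h : IsRegularSum q C w f F g R) (hz : R < 1) (hzq : 1 ≤ q * R) (m : ℕ) {P : 𝔸}
    (hCP : Commute C P) (hPP : P * P = P) (hm : (C - 1) ^ (m + 1) * P = 0) :
    ∃ Φ : ℕ → ℝ → 𝔸, IsFluctuation q R 1 Φ ∧ ∀ N : ℕ, 1 ≤ N →
      P * F N =
        (∑ k ∈ range (m + 1), ((Real.logb q N : ℂ) ^ k) • Φ k (Int.fract (Real.logb q N))) +
        ((Real.logb q N : ℂ) ^ (m + 1)) •
          ((1 / ((m + 1).factorial : ℂ)) • ((C - 1) ^ m * (P * w))) := by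
  have hq1 : (1 : ℝ) < q := by exact_mod_cast hq
  obtain ⟨H, hH1, hHN, hPH, hHα⟩ := exists_interpolation hq hR h (z := 1) (by simpa using hz)
    (m + 1) hCP hPP (by simpa using hm)
  have hΔ : ∀ t, 0 ≤ t → fwdDiff 1 H t = (C - 1) * H t + P * w := by
    intro t ht
    rw [fwdDiff, hH1 t ht, sub_mul, one_mul]
    abel
  have hzero : ∀ t, 0 ≤ t → (C - 1) ^ (m + 1) * H t = 0 := by
    intro t ht
    rw [← hPH t ht, ← mul_assoc, hm, zero_mul]
  obtain ⟨Φ, hper, hexp, hhol, htop⟩ := exists_periodic_expansion (m + 2) H (by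
    intro t ht
    rw [fwdDiff_iter_of_affine hΔ (m + 1) t ht, pow_succ', mul_assoc, hzero t ht, ← mul_assoc,
      hm, zero_mul, mul_zero, add_zero])
  refine ⟨fun k t => Φ k (Int.fract t), IsFluctuation.of_fract hq hR hzq hper ?_, ?_⟩
  · intro k α hα hα1 hαz
    exact hhol k α hα hα1 (hHα α hα (by simpa using hαz))
  · intro N hN
    have ht : 0 ≤ Real.logb q N := Real.logb_nonneg hq1 (by exact_mod_cast hN)
    simp only [apply_fract_eq (hper _) ht]
    rw [← hHN N hN, hexp _ ht, sum_range_succ _ (m + 1), htop (m + 1) rfl]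
    simp only
    rw [fwdDiff_iter_of_affine hΔ m _ ht, hzero _ ht, zero_add]

end Large

/-! ### Growth of the recursion for eigenvalues of modulus at most `R` -/

section Small

variable {𝔸 : Type*} [NormedRing 𝔸] {q : ℕ} {C : 𝔸} {R : ℝ}

theorem exists_bound_of_lt (G : ℕ → 𝔸) (R : ℝ) (q : ℕ) :
    ∃ c, 0 ≤ c ∧ ∀ n < q, ‖G n‖ ≤ c * R ^ Nat.log q n := by
  refine ⟨∑ n ∈ range q, ‖G n‖, sum_nonneg fun _ _ => norm_nonneg _, fun n hn => ?_⟩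
  rw [Nat.log_of_lt hn, pow_zero, mul_one]
  exact single_le_sum (f := fun n => ‖G n‖) (fun _ _ => norm_nonneg _) (mem_range.2 hn)

/-- `C * G` solves the same kind of recursion with a smaller exponent, so it vanishes eventually. As
`n / q` tends to infinity, so does every term on the right of the recursion for `G`. -/
theorem eventually_eq_zero_of_nilpotent (hq : 2 ≤ q) (m : ℕ)
    (G e : ℕ → 𝔸) (hG : ∀ n, 1 ≤ n → G n = C * G (n / q) + e n)
    (he : ∀ᶠ n in atTop, e n = 0) (hm : ∀ n, C ^ m * G n = 0) :
    ∀ᶠ n in atTop, G n = 0 := by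
  induction m generalizing G e with
  | zero => exact Eventually.of_forall fun n => by simpa using hm n
  | succ m ih =>
    have h1 := ih (fun n => C * G n) (fun n => C * e n)
      (fun n hn => by rw [hG n hn, mul_add])
      (he.mono fun n hn => by rw [hn, mul_zero])
      (fun n => by rw [← mul_assoc, ← pow_succ, hm])
    have h2 := (Nat.tendsto_div_const_atTop (by omega : q ≠ 0)).eventually h1
    filter_upwards [h2, he, eventually_ge_atTop 1] with n h2 h3 h4
    rw [hG n h4, h3, add_zero, h2]

variable [NormedAlgebra ℂ 𝔸]

theorem eigen_step {z : ℂ} (x : 𝔸) : C * x = z • x + (C - algebraMap ℂ 𝔸 z) * x := by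
  rw [sub_mul, ← Algebra.smul_def]; abel

theorem log_eq_log_div_add_one (hq : 2 ≤ q) {n : ℕ} (hn : q ≤ n) :
    Nat.log q n = Nat.log q (n / q) + 1 := Nat.log_of_one_lt_of_le (by omega) hn

/-- Growth of a solution of the recursion in a generalized eigenspace with `|z| < R`. -/
theorem exists_bound_of_norm_lt (hq : 2 ≤ q) (hR : 0 < R) {z : ℂ} (hz : ‖z‖ < R) (m : ℕ)
    (G e : ℕ → 𝔸) (hG : ∀ n, 1 ≤ n → G n = C * G (n / q) + e n)
    (he : ∃ c, 0 ≤ c ∧ ∀ n, ‖e n‖ ≤ c * R ^ Nat.log q n)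
    (hm : ∀ n, (C - algebraMap ℂ 𝔸 z) ^ m * G n = 0) :
    ∃ c, 0 ≤ c ∧ ∀ n, ‖G n‖ ≤ c * R ^ Nat.log q n := by
  induction m generalizing G e with
  | zero => exact ⟨0, le_rfl, fun n => by simpa using hm n⟩
  | succ m ih =>
    set Y := C - algebraMap ℂ 𝔸 z with hY
    have hYC : Commute Y C := (Commute.refl C).sub_left (Algebra.commutes z C)
    obtain ⟨b, hb, he⟩ := he
    -- `Y = C - z` commutes with `C`, so `Y * G` solves the recursion one step further down the
    -- Jordan chain.
    obtain ⟨a, ha, hG'⟩ := ih (fun n => Y * G n) (fun n => Y * e n)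
      (fun n hn => by rw [hG n hn, mul_add, ← mul_assoc, hYC.eq, mul_assoc])
      ⟨‖Y‖ * b, by positivity, fun n => (norm_mul_le _ _).trans (by
        rw [mul_assoc]; gcongr; exact he n)⟩
      (fun n => by rw [← mul_assoc, ← pow_succ, hm])
    obtain ⟨k, hk, hGk⟩ := exists_bound_of_lt G R q
    have hd : 0 < R - ‖z‖ := sub_pos.2 hz
    -- The induction on `n` closes because `‖z‖ * K + a + b * R ≤ K * R`; the entry `k` covers `n <
    -- q`.
    set K := max k ((a + b * R) / (R - ‖z‖)) with hK
    have hK1 : a + b * R ≤ K * (R - ‖z‖) := (div_le_iff₀ hd).1 (le_max_right _ _)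
    have hK0 : 0 ≤ K := hk.trans (le_max_left _ _)
    refine ⟨K, hK0, fun n => ?_⟩
    induction n using Nat.strong_induction_on with
    | _ n ihn =>
      rcases lt_or_ge n q with hn | hn
      · exact (hGk n hn).trans (by gcongr; exact le_max_left _ _)
      · have h1 := ihn (n / q) (Nat.div_lt_self (by omega) hq)
        have h2 := he n
        have h3 := hG' (n / q)
        rw [log_eq_log_div_add_one hq hn] at h2 ⊢
        rw [hG n (by omega), eigen_step (z := z)]
        have hp : 0 < R ^ Nat.log q (n / q) := by positivity
        calc _ ≤ ‖z • G (n / q)‖ + ‖(C - algebraMap ℂ 𝔸 z) * G (n / q)‖ + ‖e n‖ := norm_add₃_le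
          _ ≤ ‖z‖ * (K * R ^ Nat.log q (n / q)) + a * R ^ Nat.log q (n / q) +
              b * R ^ (Nat.log q (n / q) + 1) := by
            rw [norm_smul]; gcongr
          _ = (‖z‖ * K + (a + b * R)) * R ^ Nat.log q (n / q) := by ring
          _ ≤ (‖z‖ * K + K * (R - ‖z‖)) * R ^ Nat.log q (n / q) := by gcongr
          _ = _ := by ring

/-- Growth of a solution of the recursion in a generalized eigenspace with `|z| = R`. -/
theorem exists_bound_of_norm_eq (hq : 2 ≤ q) (hR : 0 < R) {z : ℂ} (hz : ‖z‖ = R) (m : ℕ)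
    (G e : ℕ → 𝔸) (hG : ∀ n, 1 ≤ n → G n = C * G (n / q) + e n)
    (he : ∃ c, 0 ≤ c ∧ ∀ n, ‖e n‖ ≤ c * R ^ Nat.log q n)
    (hm : ∀ n, (C - algebraMap ℂ 𝔸 z) ^ m * G n = 0) :
    ∃ c, 0 ≤ c ∧ ∀ n, ‖G n‖ ≤ c * R ^ Nat.log q n * ((Nat.log q n : ℝ) + 1) ^ m := by
  induction m generalizing G e with
  | zero => exact ⟨0, le_rfl, fun n => by simpa using hm n⟩
  | succ m ih =>
    set Y := C - algebraMap ℂ 𝔸 z with hY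
    have hYC : Commute Y C := (Commute.refl C).sub_left (Algebra.commutes z C)
    obtain ⟨b, hb, he⟩ := he
    obtain ⟨a, ha, hG'⟩ := ih (fun n => Y * G n) (fun n => Y * e n)
      (fun n hn => by rw [hG n hn, mul_add, ← mul_assoc, hYC.eq, mul_assoc])
      ⟨‖Y‖ * b, by positivity, fun n => (norm_mul_le _ _).trans (by
        rw [mul_assoc]; gcongr; exact he n)⟩
      (fun n => by rw [← mul_assoc, ← pow_succ, hm])
    obtain ⟨k, hk, hGk⟩ := exists_bound_of_lt G R q
    -- Passing from `n / q` to `n` adds at most `a / R + b ≤ K` to the coefficient `K * (l + 1)`.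
    -- Accumulated over all digits, this costs one extra power of the logarithm.
    set K := max k (a / R + b) with hK
    have hK1 : a / R + b ≤ K := le_max_right _ _
    have hK0 : 0 ≤ K := hk.trans (le_max_left _ _)
    refine ⟨K, hK0, fun n => ?_⟩
    induction n using Nat.strong_induction_on with
    | _ n ihn =>
      rcases lt_or_ge n q with hn | hn
      · refine (hGk n hn).trans ?_
        have : (1 : ℝ) ≤ ((Nat.log q n : ℝ) + 1) ^ (m + 1) :=
          one_le_pow₀ (by linarith [(Nat.cast_nonneg (Nat.log q n) : (0 : ℝ) ≤ _)])
        calc k * R ^ Nat.log q n ≤ K * R ^ Nat.log q n := by gcongr; exact le_max_left _ _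
          _ ≤ _ := le_mul_of_one_le_right (by positivity) this
      · have h1 := ihn (n / q) (Nat.div_lt_self (by omega) hq)
        have h2 := he n
        have h3 := hG' (n / q)
        rw [log_eq_log_div_add_one hq hn] at h2 ⊢
        rw [hG n (by omega), eigen_step (z := z)]
        set l := Nat.log q (n / q) with hl
        have hp : 0 < R ^ l := by positivity
        have hl0 : (0 : ℝ) ≤ l := Nat.cast_nonneg l
        have hone : (1 : ℝ) ≤ ((l : ℝ) + 1 + 1) ^ m := one_le_pow₀ (by linarith)
        have hmono : ((l : ℝ) + 1) ^ m ≤ ((l : ℝ) + 1 + 1) ^ m := by gcongr; linarith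
        push_cast
        calc _ ≤ ‖z • G (n / q)‖ + ‖(C - algebraMap ℂ 𝔸 z) * G (n / q)‖ + ‖e n‖ := norm_add₃_le
          _ ≤ R * (K * R ^ l * ((l : ℝ) + 1) ^ (m + 1)) + a * R ^ l * ((l : ℝ) + 1) ^ m +
              b * R ^ (l + 1) := by
            rw [norm_smul, hz]; gcongr
          _ ≤ R * (K * R ^ l * (((l : ℝ) + 1) * ((l : ℝ) + 1 + 1) ^ m)) +
              a * R ^ l * ((l : ℝ) + 1 + 1) ^ m + b * R ^ (l + 1) * ((l : ℝ) + 1 + 1) ^ m := by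
            rw [pow_succ' ((l : ℝ) + 1)]
            refine add_le_add (by gcongr) ?_
            exact le_mul_of_one_le_right (by positivity) hone
          _ = R ^ (l + 1) * ((l : ℝ) + 1 + 1) ^ m * (K * (l + 1) + (a / R + b)) := by
            field_simp
            ring
          _ ≤ R ^ (l + 1) * ((l : ℝ) + 1 + 1) ^ m * (K * (l + 1) + K) := by gcongr
          _ = _ := by ring

end Small

end RegularSeq

namespace RegularSeq

open Finset

/-! ### Spectral projections of a matrix in Jordan form -/

section Jordan

variable {d : ℕ}

/-- The diagonal matrix that marks the diagonal entries of `J` equal to `z`. -/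
noncomputable def diagEq (J : Matrix (Fin d) (Fin d) ℂ) (z : ℂ) : Matrix (Fin d) (Fin d) ℂ :=
  open Classical in Matrix.diagonal fun j => if J j j = z then 1 else 0

theorem one_sub_diagD (J : Matrix (Fin d) (Fin d) ℂ) : 1 - diagD J = diagEq J 1 := by
  classical
  rw [diagD, diagEq, ← Matrix.diagonal_one, Matrix.diagonal_sub]
  congr 1
  ext j
  by_cases h : J j j = 1 <;> simp [h]

theorem diagEq_mul_self (J : Matrix (Fin d) (Fin d) ℂ) (z : ℂ) :
    diagEq J z * diagEq J z = diagEq J z := by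
  classical
  rw [diagEq, Matrix.diagonal_mul_diagonal]
  congr 1
  ext j
  by_cases h : J j j = z <;> simp [h]

theorem diagEq_mul_diagEq {J : Matrix (Fin d) (Fin d) ℂ} {z z' : ℂ} (hz : z ≠ z') :
    diagEq J z * diagEq J z' = 0 := by
  classical
  rw [diagEq, diagEq, Matrix.diagonal_mul_diagonal, ← Matrix.diagonal_zero]
  congr 1
  ext j
  by_cases h : J j j = z <;> simp [h, hz]

theorem sum_diagEq {J : Matrix (Fin d) (Fin d) ℂ} {S : Finset ℂ} (hS : ∀ j, J j j ∈ S) :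
    ∑ z ∈ S, diagEq J z = 1 := by
  classical
  simp only [diagEq]
  ext i j
  rw [Matrix.sum_apply]
  by_cases h : i = j
  · subst h
    simp [hS i]
  · simp [Matrix.diagonal_apply_ne _ h, Matrix.one_apply_ne h]

theorem IsJordanForm.eq_of_ne_zero {J : Matrix (Fin d) (Fin d) ℂ} (hJ : IsJordanForm J)
    {i j : Fin d} (hij : i ≠ j) (h : J i j ≠ 0) :
    (i : ℕ) + 1 = j ∧ J i j = 1 ∧ J i i = J j j := by
  have h1 : (i : ℕ) + 1 = j := by
    by_contra h1
    exact h ((hJ i j).1 hij h1)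
  exact ⟨h1, ((hJ i j).2 h1).resolve_left h⟩

theorem IsJordanForm.commute_diagEq {J : Matrix (Fin d) (Fin d) ℂ} (hJ : IsJordanForm J) (z : ℂ) :
    Commute J (diagEq J z) := by
  classical
  ext i j
  rw [diagEq, Matrix.mul_diagonal, Matrix.diagonal_mul, mul_comm]
  by_cases h : J i j = 0
  · simp [h]
  · by_cases hij : i = j
    · rw [hij]
    · rw [(hJ.eq_of_ne_zero hij h).2.2]

/-- A nonzero entry of the `n`-th power requires a path of `n` superdiagonal ones, along which the
diagonal entry stays equal to `z`: a Jordan block on the positions `i, …, j`. -/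
theorem IsJordanForm.chain_of_ne_zero {J : Matrix (Fin d) (Fin d) ℂ} (hJ : IsJordanForm J) (z : ℂ)
    (n : ℕ) (i j : Fin d) (h : ((J - algebraMap ℂ _ z) ^ n * diagEq J z) i j ≠ 0) :
    (i : ℕ) + n = j ∧ (∀ a : Fin d, i ≤ a → a ≤ j → J a a = z) ∧
      ∀ a b : Fin d, i ≤ a → b ≤ j → (a : ℕ) + 1 = b → J a b = 1 := by
  classical
  induction n generalizing i with
  | zero =>
    rw [pow_zero, one_mul, diagEq, Matrix.diagonal_apply] at h
    split_ifs at h with h1 h2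
    · subst h1
      refine ⟨rfl, fun a ha ha' => ?_, fun a b ha hb hab => ?_⟩
      · rw [le_antisymm ha' ha, h2]
      · rw [Fin.le_def] at ha hb; omega
    · simp at h
    · simp at h
  | succ n ih =>
    rw [pow_succ', mul_assoc, Matrix.mul_apply] at h
    obtain ⟨k, -, hk⟩ := Finset.exists_ne_zero_of_sum_ne_zero h
    obtain ⟨h1, h2, h3⟩ := ih k (right_ne_zero_of_mul hk)
    have hkj : k ≤ j := by rw [Fin.le_def]; omega
    have hJk := left_ne_zero_of_mul hk
    rw [Matrix.sub_apply, Matrix.algebraMap_matrix_apply] at hJk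
    by_cases hik : i = k
    · subst hik
      exact absurd (by simp [h2 i le_rfl hkj]) hJk
    · rw [if_neg hik, sub_zero] at hJk
      obtain ⟨h4, h5, h6⟩ := hJ.eq_of_ne_zero hik hJk
      refine ⟨by omega, fun a ha ha' => ?_, fun a b ha hb hab => ?_⟩
      · by_cases hak : k ≤ a
        · exact h2 a hak ha'
        · have : a = i := by
            rw [Fin.le_def] at ha hak
            ext; omega
          rw [this, h6, h2 k le_rfl hkj]
      · by_cases hak : k ≤ a
        · exact h3 a b hak hb hab
        · rw [Fin.le_def] at ha hak
          have e1 : a = i := by ext; omega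
          have e2 : b = k := by ext; omega
          rw [e1, e2, h5]

theorem le_maxBlock {J : Matrix (Fin d) (Fin d) ℂ} {z : ℂ} {n i : ℕ} (h : i + n ≤ d)
    (hb : J.submatrix (fun a : Fin n => Fin.castLE h (Fin.natAdd i a))
      (fun a : Fin n => Fin.castLE h (Fin.natAdd i a)) = jordanBlock z n) : n ≤ maxBlock J z :=
  le_csSup ⟨d, fun k ⟨i, hi, _⟩ => by omega⟩ ⟨i, h, hb⟩

theorem maxBlock_le (J : Matrix (Fin d) (Fin d) ℂ) (z : ℂ) : maxBlock J z ≤ d :=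
  csSup_le' fun k ⟨i, hi, _⟩ => by omega

theorem IsJordanForm.sub_pow_maxBlock_mul_diagEq {J : Matrix (Fin d) (Fin d) ℂ}
    (hJ : IsJordanForm J) (z : ℂ) :
    (J - algebraMap ℂ _ z) ^ maxBlock J z * diagEq J z = 0 := by
  ext i j
  by_contra hne
  obtain ⟨h1, h2, h3⟩ := hJ.chain_of_ne_zero z _ i j hne
  -- A path of `maxBlock J z` ones visits one more position than it has steps, so it yields a block
  -- that is too large.
  have h : (i : ℕ) + (maxBlock J z + 1) ≤ d := by have := j.2; omega
  have := le_maxBlock (J := J) (z := z) h (by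
    ext a b
    rw [Matrix.submatrix_apply, jordanBlock, Matrix.of_apply]
    have ha := a.2
    have hb := b.2
    split_ifs with hab hab'
    · subst hab
      exact h2 _ (by rw [Fin.le_def]; simp) (by rw [Fin.le_def]; simp; omega)
    · refine h3 _ _ ?_ ?_ ?_
      · rw [Fin.le_def]; simp
      · rw [Fin.le_def]; simp; omega
      · simp; omega
    · refine (hJ _ _).1 ?_ ?_
      · intro he
        apply hab
        have := congrArg Fin.val he
        simp at this
        exact Fin.ext this
      · simp; omega)
  omega

theorem IsJordanForm.blockTriangular {J : Matrix (Fin d) (Fin d) ℂ} (hJ : IsJordanForm J) :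
    J.BlockTriangular id := by
  intro i j hij
  rw [id, id, Fin.lt_def] at hij
  exact (hJ i j).1 (by rintro rfl; omega) (by omega)

end Jordan

/-! ### Transport to `C`; the constants `K` and `ϑ` -/

section Conjugation

variable {d : ℕ} {T : Matrix (Fin d) (Fin d) ℂ}

/-- Conjugation `X ↦ T⁻¹ X T` as an algebra homomorphism. -/
noncomputable def conjHom (T : Matrix (Fin d) (Fin d) ℂ) (hT : IsUnit T.det) :
    Matrix (Fin d) (Fin d) ℂ →ₐ[ℂ] Matrix (Fin d) (Fin d) ℂ :=
  AlgHom.ofLinearMap ((LinearMap.mulLeft ℂ T⁻¹).comp (LinearMap.mulRight ℂ T))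
    (by simp [Matrix.nonsing_inv_mul T hT])
    (fun X Y => by
      simp only [LinearMap.comp_apply, LinearMap.mulLeft_apply, LinearMap.mulRight_apply]
      calc T⁻¹ * (X * Y * T) = T⁻¹ * (X * (T * T⁻¹) * Y * T) := by
            rw [Matrix.mul_nonsing_inv T hT, mul_one]
        _ = _ := by simp only [mul_assoc])

theorem conjHom_apply (hT : IsUnit T.det) (X : Matrix (Fin d) (Fin d) ℂ) :
    conjHom T hT X = T⁻¹ * X * T := by
  simp [conjHom, AlgHom.ofLinearMap_apply, mul_assoc]

theorem conjHom_of_eq (hT : IsUnit T.det) {C J : Matrix (Fin d) (Fin d) ℂ}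
    (h : T * C * T⁻¹ = J) : conjHom T hT J = C := by
  rw [conjHom_apply, ← h]
  calc T⁻¹ * (T * C * T⁻¹) * T = (T⁻¹ * T) * C * (T⁻¹ * T) := by simp only [mul_assoc]
    _ = C := by rw [Matrix.nonsing_inv_mul T hT, one_mul, mul_one]

theorem det_conjHom (hT : IsUnit T.det) (X : Matrix (Fin d) (Fin d) ℂ) :
    (conjHom T hT X).det = X.det := by
  rw [conjHom_apply, Matrix.det_conj' ((Matrix.isUnit_iff_isUnit_det T).2 hT)]

/-- The projection onto the generalized eigenspace of `C = T⁻¹ J T` for `z`. -/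
noncomputable def eigenProj (T J : Matrix (Fin d) (Fin d) ℂ) (hT : IsUnit T.det) (z : ℂ) :
    Matrix (Fin d) (Fin d) ℂ := conjHom T hT (diagEq J z)

variable {C J : Matrix (Fin d) (Fin d) ℂ}

theorem mem_spectrum_of_diag (hT : IsUnit T.det) (hTJ : T * C * T⁻¹ = J) (hJ : IsJordanForm J)
    (j : Fin d) : J j j ∈ spectrum ℂ C := by
  rw [spectrum.mem_iff, Matrix.isUnit_iff_isUnit_det, ← conjHom_of_eq hT hTJ,
    ← AlgHom.commutes (conjHom T hT), ← map_sub, det_conjHom]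
  have htri : (algebraMap ℂ (Matrix (Fin d) (Fin d) ℂ) (J j j) - J).BlockTriangular id := by
    refine Matrix.BlockTriangular.sub ?_ hJ.blockTriangular
    rw [Matrix.algebraMap_eq_diagonal]
    exact Matrix.blockTriangular_diagonal _
  rw [Matrix.det_of_isUpperTriangular htri, Finset.prod_eq_zero (Finset.mem_univ j) (by
    simp [Matrix.algebraMap_matrix_apply])]
  exact not_isUnit_zero

theorem eigenProj_mul_self (hT : IsUnit T.det) (z : ℂ) :
    eigenProj T J hT z * eigenProj T J hT z = eigenProj T J hT z := by
  rw [eigenProj, ← map_mul, diagEq_mul_self]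

theorem commute_eigenProj (hT : IsUnit T.det) (hTJ : T * C * T⁻¹ = J) (hJ : IsJordanForm J)
    (z : ℂ) : Commute C (eigenProj T J hT z) := by
  rw [← conjHom_of_eq hT hTJ]
  exact (hJ.commute_diagEq z).map (conjHom T hT)

theorem sub_pow_mul_eigenProj (hT : IsUnit T.det) (hTJ : T * C * T⁻¹ = J) (hJ : IsJordanForm J)
    (z : ℂ) : (C - algebraMap ℂ _ z) ^ maxBlock J z * eigenProj T J hT z = 0 := by
  rw [← conjHom_of_eq hT hTJ, eigenProj, ← AlgHom.commutes (conjHom T hT), ← map_sub, ← map_pow,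
    ← map_mul, hJ.sub_pow_maxBlock_mul_diagEq, map_zero]

theorem sum_eigenProj (hT : IsUnit T.det) {S : Finset ℂ} (hS : ∀ j, J j j ∈ S) :
    ∑ z ∈ S, eigenProj T J hT z = 1 := by
  simp only [eigenProj]
  rw [← map_sum, sum_diagEq hS, map_one]

theorem constK_eq (hT : IsUnit T.det) (A₀ : Matrix (Fin d) (Fin d) ℂ) :
    constK T J A₀ = conjHom T hT (diagD J) * ((1 - matC' T J)⁻¹ * (1 - A₀)) := by
  rw [constK, conjHom_apply, mul_assoc (T⁻¹ * diagD J * T)]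

theorem matC'_eq (hT : IsUnit T.det) (hTJ : T * C * T⁻¹ = J) :
    matC' T J = conjHom T hT (diagD J) * C := by
  rw [← conjHom_of_eq hT hTJ, ← map_mul, conjHom_apply, matC']
  simp only [mul_assoc]

/-- Up to conjugation the matrix is triangular, with diagonal entry `1` where `J j j = 1` and `1 - J
j j ≠ 0` elsewhere. Hence the inverse in `K` is a true inverse. -/
theorem isUnit_det_one_sub_matC' (hT : IsUnit T.det) (hTJ : T * C * T⁻¹ = J)
    (hJ : IsJordanForm J) : IsUnit (1 - matC' T J).det := by
  classical
  have e : 1 - matC' T J = conjHom T hT (1 - diagD J * J) := by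
    rw [matC'_eq hT hTJ, map_sub, map_one, map_mul, conjHom_of_eq hT hTJ]
  rw [e, det_conjHom]
  have htri : (1 - diagD J * J).BlockTriangular id := by
    refine Matrix.BlockTriangular.sub Matrix.blockTriangular_one ?_
    exact (Matrix.blockTriangular_diagonal _).mul hJ.blockTriangular
  rw [Matrix.det_of_isUpperTriangular htri, isUnit_iff_ne_zero, Finset.prod_ne_zero_iff]
  intro j _
  rw [Matrix.sub_apply, diagD, Matrix.diagonal_mul, Matrix.one_apply_eq]
  split_ifs with h
  · simp
  · rw [one_mul, sub_ne_zero]; exact fun h' => h h'.symm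

theorem eigenProj_mul_conj_diagD (hT : IsUnit T.det) {z : ℂ} (hz : z ≠ 1) :
    eigenProj T J hT z * conjHom T hT (diagD J) = eigenProj T J hT z := by
  have : diagD J = 1 - diagEq J 1 := by rw [← one_sub_diagD]; abel
  rw [eigenProj, ← map_mul, this, mul_sub, diagEq_mul_diagEq hz, mul_one, sub_zero]

theorem eigenProj_one_mul_constK (hT : IsUnit T.det) (A₀ : Matrix (Fin d) (Fin d) ℂ) :
    eigenProj T J hT 1 * constK T J A₀ = 0 := by
  have : diagD J = 1 - diagEq J 1 := by rw [← one_sub_diagD]; abel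
  rw [constK_eq hT, ← mul_assoc, eigenProj, ← map_mul, this, mul_sub, diagEq_mul_self, mul_one,
    sub_self, map_zero, zero_mul]

/-- With `K₀ = (I - C')⁻¹ (I - A_0)`, the equation `K₀ - C' K₀ = I - A_0` is multiplied by the
projection. For `z ≠ 1` it absorbs the factor `T⁻¹ D T` of `C'`, so the projected constant is the
fixed point needed in the expansion. -/
theorem eigenProj_mul_constK (hT : IsUnit T.det) (hTJ : T * C * T⁻¹ = J) (hJ : IsJordanForm J)
    (A₀ : Matrix (Fin d) (Fin d) ℂ) {z : ℂ} (hz : z ≠ 1) :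
    eigenProj T J hT z * constK T J A₀ =
      C * (eigenProj T J hT z * constK T J A₀) + eigenProj T J hT z * (1 - A₀) := by
  set K₀ := (1 - matC' T J)⁻¹ * (1 - A₀) with hK
  have h1 : K₀ - conjHom T hT (diagD J) * C * K₀ = 1 - A₀ := by
    rw [← matC'_eq hT hTJ, ← one_mul K₀, ← mul_assoc (matC' T J), ← sub_mul, mul_one, hK,
      ← mul_assoc, Matrix.mul_nonsing_inv _ (isUnit_det_one_sub_matC' hT hTJ hJ), one_mul]
  have h2 : eigenProj T J hT z * constK T J A₀ = eigenProj T J hT z * K₀ := by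
    rw [constK_eq hT, ← mul_assoc, eigenProj_mul_conj_diagD hT hz]
  rw [h2, ← h1, mul_sub, ← mul_assoc C, (commute_eigenProj hT hTJ hJ z).eq, ← mul_assoc _ _ K₀,
    ← mul_assoc _ _ C, eigenProj_mul_conj_diagD hT hz]
  abel

theorem theta_eq_of_maxBlock (hT : IsUnit T.det) (hTJ : T * C * T⁻¹ = J) (hJ : IsJordanForm J)
    (A₀ : Matrix (Fin d) (Fin d) ℂ) {n : ℕ} (hn : maxBlock J 1 = n + 1) :
    theta C T J A₀ = (1 / ((n + 1).factorial : ℂ)) •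
      ((C - 1) ^ n * (eigenProj T J hT 1 * (1 - A₀))) := by
  have hc : Commute ((C - 1) ^ n) (eigenProj T J hT 1) :=
    ((commute_eigenProj hT hTJ hJ 1).sub_left (Commute.one_left _)).pow_left n
  rw [theta, thetaSeq, one_sub_diagD, hn, ← conjHom_apply hT, ← eigenProj]
  have : (((n + 1 : ℕ) : ℤ) - 1) = (n : ℤ) := by push_cast; ring
  rw [this, zpow_natCast, ← mul_assoc, hc.eq]

/-- Covers `m(1) = 0`, where the exponent in `ϑ` is `-1`: the projection factor vanishes whatever
that power is. -/
theorem theta_eq_zero_of_eigenProj (hT : IsUnit T.det) (A₀ : Matrix (Fin d) (Fin d) ℂ)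
    (h : eigenProj T J hT 1 = 0) : theta C T J A₀ = 0 := by
  rw [theta, thetaSeq, one_sub_diagD, ← conjHom_apply hT, ← eigenProj, h]
  simp

theorem eigenProj_eq_zero (hT : IsUnit T.det) (hTJ : T * C * T⁻¹ = J) (hJ : IsJordanForm J)
    {z : ℂ} (hz : z ∉ spectrum ℂ C) : eigenProj T J hT z = 0 := by
  have : diagEq J z = 0 := by
    classical
    rw [diagEq, ← Matrix.diagonal_zero]
    congr 1
    ext j
    rw [if_neg]
    rintro rfl
    exact hz (mem_spectrum_of_diag hT hTJ hJ j)
  rw [eigenProj, this, map_zero]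

end Conjugation

end RegularSeq

namespace RegularSeq

open Finset Filter

/-! ### Comparison of the induced norm with the operator norm for the sup norm -/

section InducedNorm

variable {d : ℕ}

theorem seminorm_le_norm (p : Seminorm ℂ (Fin d → ℂ)) :
    ∃ b, 0 ≤ b ∧ ∀ v, p v ≤ b * ‖v‖ := by
  refine ⟨∑ i, p (Pi.single i 1), sum_nonneg fun _ _ => apply_nonneg _ _, fun v => ?_⟩
  have e : v = ∑ i, v i • (Pi.single i 1 : Fin d → ℂ) := by
    ext j; simp [Finset.sum_apply, Pi.single_apply]
  calc p v = p (∑ i, v i • (Pi.single i 1 : Fin d → ℂ)) := by rw [← e]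
    _ ≤ ∑ i, p (v i • (Pi.single i 1 : Fin d → ℂ)) := Finset.le_sum_of_subadditive p (map_zero p).le (map_add_le_add p) _ _
    _ ≤ ∑ i, p (Pi.single i 1) * ‖v‖ := by
        refine sum_le_sum fun i _ => ?_
        rw [map_smul_eq_mul, mul_comm]
        gcongr
        exact norm_le_pi_norm v i
    _ = _ := by rw [sum_mul]

/-- `p` is continuous and has a positive minimum on the compact unit sphere, which is nonempty
because `d ≥ 1`. -/
theorem norm_le_seminorm (hd : 1 ≤ d) (p : Seminorm ℂ (Fin d → ℂ)) (hp : ∀ v, p v = 0 → v = 0) :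
    ∃ a, 0 ≤ a ∧ ∀ v, ‖v‖ ≤ a * p v := by
  obtain ⟨b, hb, hpb⟩ := seminorm_le_norm p
  have : Nonempty (Fin d) := ⟨⟨0, hd⟩⟩
  have hcont : Continuous p := by
    refine (LipschitzWith.of_dist_le_mul (K := ⟨b, hb⟩) fun x y => ?_).continuous
    rw [Real.dist_eq, dist_eq_norm]
    exact (abs_sub_map_le_sub p x y).trans (hpb _)
  obtain ⟨u, hu, hmin⟩ := (isCompact_sphere (0 : Fin d → ℂ) 1).exists_isMinOn
    (NormedSpace.sphere_nonempty.2 zero_le_one) hcont.continuousOn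
  rw [mem_sphere_zero_iff_norm] at hu
  have hpu : 0 < p u := (apply_nonneg p u).lt_of_ne fun h => by
    rw [hp u h.symm, norm_zero] at hu
    exact zero_ne_one hu
  refine ⟨(p u)⁻¹, by positivity, fun v => ?_⟩
  rcases eq_or_ne v 0 with rfl | hv
  · simp
  have hv' : 0 < ‖v‖ := norm_pos_iff.2 hv
  have h1 : p u ≤ p (((‖v‖⁻¹ : ℝ) : ℂ) • v) := by
    apply hmin
    rw [mem_sphere_zero_iff_norm, norm_smul, Complex.norm_real, norm_inv, norm_norm,
      inv_mul_cancel₀ hv'.ne']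
  rw [map_smul_eq_mul, Complex.norm_real, norm_inv, norm_norm, inv_mul_eq_div,
    le_div_iff₀ hv'] at h1
  rw [inv_mul_eq_div, le_div_iff₀ hpu]
  linarith

attribute [local instance] Matrix.linftyOpNormedRing Matrix.linftyOpNormedAlgebra

theorem inducedNorm_nonneg (p : Seminorm ℂ (Fin d → ℂ)) (M : Matrix (Fin d) (Fin d) ℂ) :
    0 ≤ inducedNorm p M := Real.sInf_nonneg fun _ h => h.1

theorem inducedNorm_le {p : Seminorm ℂ (Fin d → ℂ)} {M : Matrix (Fin d) (Fin d) ℂ} {c : ℝ}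
    (hc : 0 ≤ c) (h : ∀ v, p (M.mulVec v) ≤ c * p v) : inducedNorm p M ≤ c :=
  csInf_le ⟨0, fun _ h => h.1⟩ ⟨hc, h⟩

/-- Shows that the set in the definition of `inducedNorm` is nonempty; the infimum of an empty set
would be `0` by default. -/
theorem exists_mulVec_le (hd : 1 ≤ d) (p : Seminorm ℂ (Fin d → ℂ)) (hp : ∀ v, p v = 0 → v = 0) :
    ∃ a, 0 ≤ a ∧ ∀ M : Matrix (Fin d) (Fin d) ℂ, ∀ v, p (M.mulVec v) ≤ a * ‖M‖ * p v := by
  obtain ⟨b, hb, hpb⟩ := seminorm_le_norm p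
  obtain ⟨a, ha, hpa⟩ := norm_le_seminorm hd p hp
  refine ⟨b * a, by positivity, fun M v => ?_⟩
  calc _ ≤ b * ‖M.mulVec v‖ := hpb _
    _ ≤ b * (‖M‖ * (a * p v)) := by
        gcongr
        refine (Matrix.linfty_opNorm_mulVec M v).trans ?_
        gcongr
        exact hpa v
    _ = _ := by ring

theorem mulVec_le_inducedNorm (hd : 1 ≤ d) {p : Seminorm ℂ (Fin d → ℂ)}
    (hp : ∀ v, p v = 0 → v = 0) (M : Matrix (Fin d) (Fin d) ℂ) (v : Fin d → ℂ) :
    p (M.mulVec v) ≤ inducedNorm p M * p v := by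
  obtain ⟨a, ha, hM⟩ := exists_mulVec_le hd p hp
  rcases eq_or_ne (p v) 0 with h | h
  · rw [hp v h]; simp
  · have hpv : 0 < p v := (apply_nonneg p v).lt_of_ne h.symm
    rw [← div_le_iff₀ hpv]
    refine le_csInf ⟨a * ‖M‖, by positivity, hM M⟩ fun c hc => ?_
    rw [div_le_iff₀ hpv]
    exact hc.2 v

theorem inducedNorm_mul_le (hd : 1 ≤ d) {p : Seminorm ℂ (Fin d → ℂ)}
    (hp : ∀ v, p v = 0 → v = 0) (M N : Matrix (Fin d) (Fin d) ℂ) :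
    inducedNorm p (M * N) ≤ inducedNorm p M * inducedNorm p N := by
  have hM := inducedNorm_nonneg p M
  refine inducedNorm_le (mul_nonneg hM (inducedNorm_nonneg p N)) fun v => ?_
  rw [← Matrix.mulVec_mulVec]
  refine (mulVec_le_inducedNorm hd hp _ _).trans ?_
  rw [mul_assoc]
  gcongr
  exact mulVec_le_inducedNorm hd hp _ _

theorem exists_inducedNorm_le_norm (hd : 1 ≤ d) (p : Seminorm ℂ (Fin d → ℂ))
    (hp : ∀ v, p v = 0 → v = 0) :
    ∃ a, 0 ≤ a ∧ ∀ M : Matrix (Fin d) (Fin d) ℂ, inducedNorm p M ≤ a * ‖M‖ := by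
  obtain ⟨a, ha, hM⟩ := exists_mulVec_le hd p hp
  exact ⟨a, ha, fun M => inducedNorm_le (by positivity) (hM M)⟩

theorem exists_norm_le_inducedNorm (hd : 1 ≤ d) (p : Seminorm ℂ (Fin d → ℂ))
    (hp : ∀ v, p v = 0 → v = 0) :
    ∃ a, 0 ≤ a ∧ ∀ M : Matrix (Fin d) (Fin d) ℂ, ‖M‖ ≤ a * inducedNorm p M := by
  obtain ⟨b, hb, hpb⟩ := seminorm_le_norm p
  obtain ⟨a, ha, hpa⟩ := norm_le_seminorm hd p hp
  refine ⟨a * b, by positivity, fun M => ?_⟩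
  have hM := inducedNorm_nonneg p M
  rw [Matrix.linfty_opNorm_eq_opNorm]
  refine ContinuousLinearMap.opNorm_le_bound _ (by positivity) fun v => ?_
  calc ‖M.mulVec v‖ ≤ a * p (M.mulVec v) := hpa _
    _ ≤ a * (inducedNorm p M * (b * ‖v‖)) := by
        gcongr
        refine (mulVec_le_inducedNorm hd hp M v).trans ?_
        gcongr
        exact hpb v
    _ = _ := by ring

end InducedNorm

/-! ### Matrix products, admissible radii and the growth of `f` -/

section Words

variable {q d : ℕ} {p : Seminorm ℂ (Fin d → ℂ)} {A : Fin q → Matrix (Fin d) (Fin d) ℂ} {R : ℝ}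

theorem rhoLen_nonneg (l : ℕ) : 0 ≤ rhoLen p A l :=
  Real.iSup_nonneg fun _ => Real.rpow_nonneg (inducedNorm_nonneg _ _) _

theorem jointSpectralRadius_nonneg : 0 ≤ jointSpectralRadius p A :=
  Real.iInf_nonneg fun _ => rhoLen_nonneg _

theorem IsAdmissibleRadius.le (hR : IsAdmissibleRadius p A R) : jointSpectralRadius p A ≤ R := by
  by_cases h : FinitenessProperty p A
  · exact (hR.1 h).ge
  · exact (hR.2 h).1.le

/-- No eigenvalue has modulus in `(ρ, R]`, so `ρ` and `R` are interchangeable as thresholds. -/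
theorem IsAdmissibleRadius.lt_iff (hR : IsAdmissibleRadius p A R) {z : ℂ}
    (hz : z ∈ spectrum ℂ (sumMat A)) : jointSpectralRadius p A < ‖z‖ ↔ R < ‖z‖ := by
  refine ⟨fun h => ?_, fun h => hR.le.trans_lt h⟩
  by_cases hf : FinitenessProperty p A
  · rwa [hR.1 hf]
  · by_contra h'
    exact (hR.2 hf).2 z hz ⟨h, not_lt.1 h'⟩

/-- Either the infimum `ρ = R` is attained at some `l`, or `R` exceeds the infimum and so exceeds
some `ρ_l`. -/
theorem IsAdmissibleRadius.exists_word_bound (hR : IsAdmissibleRadius p A R) :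
    ∃ l : ℕ, 0 < l ∧
      ∀ r : Fin l → Fin q, inducedNorm p (List.ofFn fun i => A (r i)).prod ≤ R ^ l := by
  have hR0 : 0 ≤ R := jointSpectralRadius_nonneg.trans hR.le
  have : ∃ l : ℕ, 0 < l ∧ rhoLen p A l ≤ R := by
    by_cases hf : FinitenessProperty p A
    · obtain ⟨l, hl, h⟩ := hf
      exact ⟨l, hl, by rw [← h, hR.1 ⟨l, hl, h⟩]⟩
    · obtain ⟨l, hl⟩ := exists_lt_of_ciInf_lt (hR.2 hf).1
      exact ⟨l, l.pos, hl.le⟩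
  obtain ⟨l, hl, h⟩ := this
  refine ⟨l, hl, fun r => ?_⟩
  have h1 := (le_ciSup (f := fun r : Fin l → Fin q =>
    (inducedNorm p (List.ofFn fun i => A (r i)).prod) ^ (1 / (l : ℝ)))
    (Set.finite_range _).bddAbove r).trans h
  have h0 := inducedNorm_nonneg p (List.ofFn fun i => A (r i)).prod
  rw [one_div] at h1
  calc _ = ((inducedNorm p (List.ofFn fun i => A (r i)).prod) ^ ((l : ℝ)⁻¹)) ^ l :=
        (Real.rpow_inv_natCast_pow h0 hl.ne').symm
    _ ≤ R ^ l := by gcongr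

theorem sumMat_pow (l : ℕ) :
    sumMat A ^ l = ∑ r : Fin l → Fin q, (List.ofFn fun i => A (r i)).prod := by
  induction l with
  | zero => simp
  | succ l ih =>
    rw [pow_succ', ih, sumMat, ← (Fin.consEquiv fun _ => Fin q).sum_comp, Fintype.sum_prod_type,
      sum_mul]
    refine sum_congr rfl fun a _ => ?_
    rw [mul_sum]
    refine sum_congr rfl fun r _ => ?_
    simp [Fin.consEquiv, List.ofFn_succ]

/-- `C ^ l` is a sum of `q ^ l` products, each of norm at most `R ^ l`; applying it to an
eigenvector gives `‖z‖ ^ l ≤ (q R) ^ l`. -/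
theorem norm_le_of_mem_spectrum (hd : 1 ≤ d) (hp : ∀ v, p v = 0 → v = 0) (hR0 : 0 ≤ R) {l : ℕ}
    (hl : 0 < l)
    (h : ∀ r : Fin l → Fin q, inducedNorm p (List.ofFn fun i => A (r i)).prod ≤ R ^ l) {z : ℂ}
    (hz : z ∈ spectrum ℂ (sumMat A)) : ‖z‖ ≤ q * R := by
  rw [spectrum.mem_iff, Matrix.isUnit_iff_isUnit_det, isUnit_iff_ne_zero, not_not,
    ← Matrix.exists_mulVec_eq_zero_iff] at hz
  obtain ⟨v, hv, hzv⟩ := hz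
  have hev : (sumMat A).mulVec v = z • v := by
    rw [Matrix.sub_mulVec, sub_eq_zero, Algebra.algebraMap_eq_smul_one, Matrix.smul_mulVec,
      Matrix.one_mulVec] at hzv
    exact hzv.symm
  have hpow : ∀ k : ℕ, (sumMat A ^ k).mulVec v = z ^ k • v := by
    intro k
    induction k with
    | zero => simp
    | succ k ih =>
      rw [pow_succ, ← Matrix.mulVec_mulVec, hev, Matrix.mulVec_smul, ih, smul_smul, pow_succ']
  have hpv : 0 < p v := (apply_nonneg p v).lt_of_ne fun h => hv (hp v h.symm)
  have key : ‖z‖ ^ l * p v ≤ (q * R) ^ l * p v := by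
    calc ‖z‖ ^ l * p v = p ((sumMat A ^ l).mulVec v) := by rw [hpow, map_smul_eq_mul, norm_pow]
      _ ≤ ∑ r : Fin l → Fin q, p ((List.ofFn fun i => A (r i)).prod.mulVec v) := by
          rw [sumMat_pow, Matrix.sum_mulVec]
          exact Finset.le_sum_of_subadditive p (map_zero p).le (map_add_le_add p) _ _
      _ ≤ ∑ r : Fin l → Fin q, R ^ l * p v := by
          refine sum_le_sum fun r _ => (mulVec_le_inducedNorm hd hp _ _).trans ?_
          gcongr
          exact h r
      _ = _ := by
          rw [sum_const, card_univ, Fintype.card_fun, Fintype.card_fin, Fintype.card_fin,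
            nsmul_eq_mul, mul_pow]
          push_cast
          ring
  exact le_of_pow_le_pow_left₀ hl.ne' (by positivity) (le_of_mul_le_mul_right key hpv)

variable {f : ℕ → Matrix (Fin d) (Fin d) ℂ}

theorem exists_word (hq : 2 ≤ q)
    (hf : ∀ (n : ℕ) (r : Fin q), q * n + r ≠ 0 → f (q * n + r) = A r * f n) (l n : ℕ)
    (hn : q ^ l ≤ n) :
    ∃ r : Fin l → Fin q, f n = (List.ofFn fun i => A (r i)).prod * f (n / q ^ l) := by
  induction l generalizing n with
  | zero => exact ⟨Fin.elim0, by simp⟩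
  | succ l ih =>
    have h1 : q ^ l ≤ n / q := by
      rw [Nat.le_div_iff_mul_le (by omega), ← pow_succ]; exact hn
    obtain ⟨r, hr⟩ := ih _ h1
    have h0 : 0 < q ^ (l + 1) := Nat.pow_pos (by omega)
    refine ⟨Fin.cons ⟨n % q, Nat.mod_lt _ (by omega)⟩ r, ?_⟩
    have h2 := hf (n / q) ⟨n % q, Nat.mod_lt _ (by omega)⟩
    simp only [Nat.div_add_mod] at h2
    rw [h2 (by omega), hr, List.ofFn_succ, List.prod_cons, Nat.div_div_eq_div_mul, ← pow_succ',
      mul_assoc]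
    simp

/-- Stripping `l` digits costs a factor `R ^ l` and lowers `Nat.log q n` by exactly `l`; the
constant takes care of `n < q ^ l`. -/
theorem exists_bound_of_word_bound (hq : 2 ≤ q) (hd : 1 ≤ d) (hp : ∀ v, p v = 0 → v = 0)
    (hf : ∀ (n : ℕ) (r : Fin q), q * n + r ≠ 0 → f (q * n + r) = A r * f n) (hR : 0 < R) {l : ℕ}
    (hl : 0 < l)
    (h : ∀ r : Fin l → Fin q, inducedNorm p (List.ofFn fun i => A (r i)).prod ≤ R ^ l) :
    ∃ c, 0 ≤ c ∧ ∀ n, inducedNorm p (f n) ≤ c * R ^ Nat.log q n := by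
  have hterm : ∀ n, 0 ≤ inducedNorm p (f n) / R ^ Nat.log q n := fun n =>
    div_nonneg (inducedNorm_nonneg _ _) (by positivity)
  have hc : 0 ≤ ∑ n ∈ range (q ^ l), inducedNorm p (f n) / R ^ Nat.log q n :=
    sum_nonneg fun n _ => hterm n
  refine ⟨_, hc, fun n => ?_⟩
  induction n using Nat.strong_induction_on with
  | _ n ih =>
    rcases lt_or_ge n (q ^ l) with hn | hn
    · rw [← div_le_iff₀ (by positivity)]
      exact single_le_sum (f := fun n => inducedNorm p (f n) / R ^ Nat.log q n)
        (fun n _ => hterm n) (mem_range.2 hn)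
    · obtain ⟨r, hr⟩ := exists_word hq hf l n hn
      have hql : 1 < q ^ l := Nat.one_lt_pow hl.ne' (by omega)
      have h1 := ih (n / q ^ l) (Nat.div_lt_self (by omega) hql)
      have h2 : Nat.log q n = l + Nat.log q (n / q ^ l) := by
        rw [Nat.log_div_base_pow]
        have := Nat.le_log_of_pow_le (by omega : 1 < q) hn
        omega
      rw [hr, h2, pow_add]
      refine (inducedNorm_mul_le hd hp _ _).trans ?_
      calc _ ≤ R ^ l * _ := mul_le_mul (h r) h1 (inducedNorm_nonneg _ _) (by positivity)
        _ = _ := by ring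

theorem eventually_eq_zero_of_word_bound (hq : 2 ≤ q) (hd : 1 ≤ d) (hp : ∀ v, p v = 0 → v = 0)
    (hf : ∀ (n : ℕ) (r : Fin q), q * n + r ≠ 0 → f (q * n + r) = A r * f n) {l : ℕ}
    (hl : 0 < l)
    (h : ∀ r : Fin l → Fin q, inducedNorm p (List.ofFn fun i => A (r i)).prod ≤ (0 : ℝ) ^ l) :
    ∀ᶠ n in atTop, f n = 0 := by
  let _ := Matrix.linftyOpNormedRing (n := Fin d) (α := ℂ)
  obtain ⟨a, ha, hN⟩ := exists_norm_le_inducedNorm hd p hp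
  filter_upwards [eventually_ge_atTop (q ^ l)] with n hn
  obtain ⟨r, hr⟩ := exists_word hq hf l n hn
  have h1 := h r
  rw [zero_pow hl.ne'] at h1
  have h2 := hN (List.ofFn fun i => A (r i)).prod
  have h3 : ‖(List.ofFn fun i => A (r i)).prod‖ ≤ 0 :=
    h2.trans (mul_nonpos_of_nonneg_of_nonpos ha h1)
  rw [hr, norm_le_zero_iff.1 h3, zero_mul]

end Words

/-! ### The recursion for the summatory function -/

section Recursion

variable {q : ℕ} {𝔸 : Type*} [NormedRing 𝔸] {A : Fin q → 𝔸} {f : ℕ → 𝔸}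

/-- `B_k = A_0 + ⋯ + A_{k-1}`. -/
def partialSum (A : Fin q → 𝔸) (k : ℕ) : 𝔸 :=
  ∑ j ∈ range k, if h : j < q then A ⟨j, h⟩ else 0

theorem partialSum_self : partialSum A q = ∑ r, A r := by
  rw [partialSum, ← Fin.sum_univ_eq_sum_range (fun j => if h : j < q then A ⟨j, h⟩ else 0)]
  simp

theorem sum_range_mul_add {f' : ℕ → 𝔸}
    (hf : ∀ (n : ℕ) (r : Fin q), f' (q * n + r) = A r * f n) (n r : ℕ) (hr : r ≤ q) :
    ∑ k ∈ range (q * n + r), f' k =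
      (∑ r, A r) * (∑ k ∈ range n, f k) + partialSum A r * f n := by
  have block : ∀ n r : ℕ, r ≤ q → ∑ j ∈ range r, f' (q * n + j) = partialSum A r * f n := by
    intro n r hr
    rw [partialSum, sum_mul]
    refine sum_congr rfl fun j hj => ?_
    have hjq : j < q := (mem_range.1 hj).trans_le hr
    rw [dif_pos hjq]
    exact hf n ⟨j, hjq⟩
  rw [sum_range_add, block n r hr]
  congr 1
  induction n with
  | zero => simp
  | succ n ih =>
    rw [mul_add, mul_one, sum_range_add, ih, block n q le_rfl, partialSum_self, sum_range_succ,
      mul_add]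

theorem sum_range_recursion (hq : 2 ≤ q) (hf0 : f 0 = 1)
    (hf : ∀ (n : ℕ) (r : Fin q), q * n + r ≠ 0 → f (q * n + r) = A r * f n) (n : ℕ) (hn : 1 ≤ n) :
    ∑ k ∈ range n, f k = (∑ r, A r) * (∑ k ∈ range (n / q), f k) +
      partialSum A (n % q) * f (n / q) + (1 - A ⟨0, by omega⟩) := by
  set w := 1 - A ⟨0, by omega⟩ with hw
  -- Changing the value at `0` from `I` to `A_0` removes the exception in the digit recursion. For
  -- `n ≥ 1` the partial sums change exactly by `w`.
  set f' : ℕ → 𝔸 := fun k => f k - if k = 0 then w else 0 with hf'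
  have h1 : ∀ (n : ℕ) (r : Fin q), f' (q * n + r) = A r * f n := by
    intro n r
    by_cases h : q * n + r = 0
    · have hn : n = 0 := by
        have h' : q * n = 0 := by omega
        exact (Nat.mul_eq_zero.1 h').resolve_left (by omega)
      have hr : r = ⟨0, by omega⟩ := Fin.ext (by simp; omega)
      subst hn
      rw [hr]
      simp [hf', hf0, hw]
    · simp only [hf', if_neg h, sub_zero]
      exact hf n r h
  have h2 := sum_range_mul_add h1 (n / q) (n % q) (Nat.mod_lt _ (by omega)).le
  rw [Nat.div_add_mod] at h2
  rw [← h2, hf', sum_sub_distrib, sum_ite_eq' (range n) 0, if_pos (mem_range.2 hn)]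
  abel

theorem isRegularSum_sum_range (hq : 2 ≤ q) (hf0 : f 0 = 1)
    (hf : ∀ (n : ℕ) (r : Fin q), q * n + r ≠ 0 → f (q * n + r) = A r * f n) {R : ℝ}
    (hbound : ∃ c, 0 ≤ c ∧ ∀ n, ‖f n‖ ≤ c * R ^ Nat.log q n) :
    IsRegularSum q (∑ r, A r) (1 - A ⟨0, by omega⟩) f (fun n => ∑ k ∈ range n, f k)
      (fun n => partialSum A (n % q) * f (n / q)) R where
  step n := sum_range_succ _ _
  recursion n hn := sum_range_recursion hq hf0 hf n hn
  correction_mul n := by simp [partialSum]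
  bound := hbound
  correction_bound := by
    obtain ⟨c, hc, H⟩ := hbound
    have hB : 0 ≤ ∑ r ∈ range q, ‖partialSum A r‖ := sum_nonneg fun _ _ => norm_nonneg _
    refine ⟨(∑ r ∈ range q, ‖partialSum A r‖) * c, by positivity, fun n => ?_⟩
    refine (norm_mul_le _ _).trans ?_
    rw [mul_assoc]
    refine mul_le_mul ?_ (H _) (norm_nonneg _) hB
    exact single_le_sum (f := fun r => ‖partialSum A r‖) (fun _ _ => norm_nonneg _)
      (mem_range.2 (Nat.mod_lt _ (by omega)))

end Recursion

end RegularSeq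

namespace RegularSeq

open Finset Filter Asymptotics

/-! ### Comparison of `Nat.log` with the error scale -/

section Scale

variable {q d : ℕ} {R : ℝ}

theorem natLog_le_logb_and_lt (q N : ℕ) (hq : 2 ≤ q) (hN : 1 ≤ N) :
    (Nat.log q N : ℝ) ≤ Real.logb q N ∧ Real.logb q N < Nat.log q N + 1 := by
  have h0 : 0 ≤ Real.logb q N :=
    Real.logb_nonneg (by exact_mod_cast hq) (by exact_mod_cast hN)
  rw [← Real.natFloor_logb_natCast]
  exact ⟨Nat.floor_le h0, Nat.lt_floor_add_one _⟩

theorem tendsto_natLog (hq : 2 ≤ q) : Tendsto (Nat.log q) atTop atTop := by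
  refine tendsto_atTop.2 fun b => ?_
  filter_upwards [eventually_ge_atTop (q ^ b)] with n hn
  exact Nat.le_log_of_pow_le (by omega) hn

/-- `N ^ log_q R = R ^ log_q N`, and rounding the exponent down changes it by less than `1`; this
costs at most `R⁻¹` when `R < 1`. -/
theorem pow_natLog_le (hq : 2 ≤ q) (hR : 0 < R) {N : ℕ} (hN : 1 ≤ N) :
    R ^ Nat.log q N ≤ max 1 R⁻¹ * (N : ℝ) ^ Real.logb q R := by
  obtain ⟨h1, h2⟩ := natLog_le_logb_and_lt q N hq hN
  have hq1 : (1 : ℝ) < q := by exact_mod_cast hq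
  have hN0 : (0 : ℝ) < N := by exact_mod_cast hN
  have e : (N : ℝ) ^ Real.logb q R = R ^ Real.logb q N := by
    rw [Real.rpow_def_of_pos hN0, Real.rpow_def_of_pos hR, Real.logb, Real.logb]
    ring_nf
  have e2 : R ^ Nat.log q N = R ^ ((Nat.log q N : ℝ) - Real.logb q N) * R ^ Real.logb q N := by
    rw [← Real.rpow_add hR, sub_add_cancel, Real.rpow_natCast]
  rw [e, e2]
  refine mul_le_mul_of_nonneg_right ?_ (by positivity)
  rcases le_total 1 R with h | h
  · exact (Real.rpow_le_one_of_one_le_of_nonpos h (by linarith)).trans (le_max_left _ _)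
  · refine le_trans ?_ (le_max_right _ _)
    rw [← Real.rpow_neg_one]
    exact Real.rpow_le_rpow_of_exponent_ge hR h (by linarith)

theorem natLog_add_one_pow_le (hq : 2 ≤ q) {m M N : ℕ} (hm : m ≤ M) (hN : 3 ≤ N) :
    ((Nat.log q N : ℝ) + 1) ^ m ≤ ((Real.log q)⁻¹ + 1) ^ m * Real.log N ^ M := by
  obtain ⟨h1, -⟩ := natLog_le_logb_and_lt q N hq (by omega)
  have hlogq : 0 < Real.log q := Real.log_pos (by exact_mod_cast hq)
  -- Since `N ≥ 3 > e`, raising the exponent of `log N` from `m` to `M` only increases the bound.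
  have hlog : 1 ≤ Real.log N := by
    rw [Real.le_log_iff_exp_le (by positivity)]
    have : (3 : ℝ) ≤ N := by exact_mod_cast hN
    linarith [Real.exp_one_lt_d9]
  have h2 : (Nat.log q N : ℝ) + 1 ≤ ((Real.log q)⁻¹ + 1) * Real.log N := by
    rw [Real.logb, div_eq_inv_mul] at h1
    rw [add_mul, one_mul]
    exact add_le_add h1 hlog
  calc _ ≤ (((Real.log q)⁻¹ + 1) * Real.log N) ^ m := by gcongr
    _ = ((Real.log q)⁻¹ + 1) ^ m * Real.log N ^ m := mul_pow _ _ _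
    _ ≤ _ := by gcongr

theorem isBigO_errorScale (hq : 2 ≤ q) (hR : 0 < R) (J : Matrix (Fin d) (Fin d) ℂ) {m : ℕ}
    (hm : m ≤ sSup {m : ℕ | ∃ z : ℂ, ‖z‖ = R ∧ m = maxBlock J z}) :
    (fun N : ℕ => R ^ Nat.log q N * ((Nat.log q N : ℝ) + 1) ^ m) =O[atTop]
      (fun N : ℕ => errorScale q J R N) := by
  refine IsBigO.of_bound (max 1 R⁻¹ * ((Real.log q)⁻¹ + 1) ^ m) ?_
  filter_upwards [eventually_ge_atTop 3] with N hN
  have h1 := pow_natLog_le hq hR (by omega : 1 ≤ N)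
  have h2 := natLog_add_one_pow_le hq hm hN
  have hlogq : 0 < Real.log q := Real.log_pos (by exact_mod_cast hq)
  rw [Real.norm_of_nonneg (by positivity)]
  refine le_trans ?_ (mul_le_mul_of_nonneg_left (Real.le_norm_self _)
    (mul_nonneg ((zero_le_one).trans (le_max_left _ _)) (by positivity)))
  rw [errorScale, if_neg hR.ne']
  calc _ ≤ (max 1 R⁻¹ * (N : ℝ) ^ Real.logb q R) * (((Real.log q)⁻¹ + 1) ^ m *
        Real.log N ^ sSup {m : ℕ | ∃ z : ℂ, ‖z‖ = R ∧ m = maxBlock J z}) := by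
        gcongr
    _ = _ := by ring

theorem maxBlock_le_sSup (J : Matrix (Fin d) (Fin d) ℂ) {z : ℂ} (hz : ‖z‖ = R) :
    maxBlock J z ≤ sSup {m : ℕ | ∃ z : ℂ, ‖z‖ = R ∧ m = maxBlock J z} :=
  le_csSup ⟨d, fun _ ⟨_, _, h⟩ => h ▸ maxBlock_le _ _⟩ ⟨z, hz, rfl⟩

theorem isBigO_natLog_pow (hq : 2 ≤ q) (hR : 1 < R) (m : ℕ) :
    (fun N : ℕ => ((Nat.log q N : ℝ) + 1) ^ m) =O[atTop] (fun N : ℕ => R ^ Nat.log q N) := by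
  have h := ((isLittleO_pow_const_const_pow_of_one_lt (R := ℝ) m hR).isBigO).comp_tendsto
    ((tendsto_add_atTop_nat 1).comp (tendsto_natLog hq))
  have h2 : (fun N : ℕ => R ^ (Nat.log q N + 1)) =O[atTop] (fun N : ℕ => R ^ Nat.log q N) := by
    simp only [pow_succ']
    exact (isBigO_refl _ _).const_mul_left R
  refine (h.trans h2).congr_left fun N => ?_
  simp [Function.comp]

theorem natCast_cpow (q : ℕ) (z : ℂ) {N : ℕ} (hN : 1 ≤ N) :
    (N : ℂ) ^ (Complex.log z / (Real.log q : ℂ)) =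
      Complex.exp ((Real.logb q N : ℂ) * Complex.log z) := by
  have hN0 : (N : ℂ) ≠ 0 := by exact_mod_cast (by omega : N ≠ 0)
  rw [Complex.cpow_def_of_ne_zero hN0, ← Complex.natCast_log, Real.logb]
  push_cast
  ring_nf

end Scale

/-! ### Expansion and error bound in each generalized eigenspace -/

section Components

variable {q d : ℕ} {R : ℝ} {C T J A₀ : Matrix (Fin d) (Fin d) ℂ}
  {f F g : ℕ → Matrix (Fin d) (Fin d) ℂ}

/-- The part of `ϑ` in the generalized eigenspace for `z`. -/
noncomputable def thetaPart (C T J A₀ : Matrix (Fin d) (Fin d) ℂ) (z : ℂ) :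
    Matrix (Fin d) (Fin d) ℂ :=
  open Classical in if z = 1 then theta C T J A₀ else 0

attribute [local instance] Matrix.linftyOpNormedRing Matrix.linftyOpNormedAlgebra

theorem exists_component_expansion (hq : 2 ≤ q) (hR : 0 < R)
    (h : IsRegularSum q C (1 - A₀) f F g R) (hT : IsUnit T.det) (hTJ : T * C * T⁻¹ = J)
    (hJ : IsJordanForm J) {z : ℂ} (hz : R < ‖z‖) (hzq : ‖z‖ ≤ q * R) :
    ∃ Φ : ℕ → ℝ → Matrix (Fin d) (Fin d) ℂ, IsFluctuation q R ‖z‖ Φ ∧ ∀ N : ℕ, 1 ≤ N →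
      eigenProj T J hT z * F N = ((N : ℂ) ^ (Complex.log z / (Real.log q : ℂ))) •
        (∑ k ∈ range (maxBlock J z),
          ((Real.logb q N : ℂ) ^ k) • Φ k (Int.fract (Real.logb q N))) +
        ((Real.logb q N : ℂ) ^ maxBlock J 1) • thetaPart C T J A₀ z +
        eigenProj T J hT z * constK T J A₀ := by
  have hcomp : CompleteSpace (Matrix (Fin d) (Fin d) ℂ) := FiniteDimensional.complete ℂ _
  have hm := sub_pow_mul_eigenProj hT hTJ hJ z
  have hC := commute_eigenProj hT hTJ hJ z
  have hP := eigenProj_mul_self (J := J) hT z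
  by_cases h1 : z = 1
  · subst h1
    rw [eigenProj_one_mul_constK]
    simp only [thetaPart, if_true]
    rw [norm_one] at hz hzq ⊢
    rcases hn : maxBlock J 1 with _ | n
    · rw [hn, pow_zero, one_mul] at hm
      refine ⟨fun _ _ => 0, ⟨fun _ _ => rfl, fun _ _ _ _ => ⟨0, le_rfl, by simp⟩⟩, fun N hN => ?_⟩
      rw [hm, theta_eq_zero_of_eigenProj hT A₀ hm]
      simp
    · rw [hn, map_one] at hm
      obtain ⟨Φ, hΦ, H⟩ := exists_expansion_one hq hR h hz hzq n hC hP hm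
      refine ⟨Φ, hΦ, fun N hN => ?_⟩
      rw [H N hN, theta_eq_of_maxBlock hT hTJ hJ A₀ hn, Complex.log_one, zero_div,
        Complex.cpow_zero, one_smul, add_zero]
  · obtain ⟨Φ, hΦ, H⟩ := exists_expansion_of_ne_one hq hR h hz hzq _ hC hP hm
      (κ := eigenProj T J hT z * constK T J A₀) (by rw [← mul_assoc, hP])
      (eigenProj_mul_constK hT hTJ hJ A₀ h1)
    refine ⟨Φ, hΦ, fun N hN => ?_⟩
    rw [H N hN, natCast_cpow q z hN]
    simp [thetaPart, h1]

/-- Passing from `log (n / q)` to `log n` costs at most a factor `max 1 R⁻¹`. -/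
theorem exists_bound_add_const (hq : 2 ≤ q) (hR : 0 < R) (h : IsRegularSum q C (1 - A₀) f F g R)
    (P : Matrix (Fin d) (Fin d) ℂ) :
    ∃ c, 0 ≤ c ∧ ∀ n, ‖P * g n‖ ≤ c * R ^ Nat.log q n := by
  obtain ⟨c, hc, hg⟩ := h.correction_bound
  refine ⟨‖P‖ * (c * max 1 R⁻¹), by positivity, fun n => (norm_mul_le _ _).trans ?_⟩
  rw [mul_assoc]
  gcongr
  refine (hg n).trans ?_
  rw [mul_assoc]
  gcongr
  rcases lt_or_ge n q with hn | hn
  · rw [Nat.div_eq_of_lt hn, Nat.log_of_lt hn, Nat.log_zero_right, pow_zero, mul_one]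
    exact le_max_left _ _
  · rw [log_eq_log_div_add_one hq hn, pow_succ]
    calc R ^ Nat.log q (n / q) = R⁻¹ * (R ^ Nat.log q (n / q) * R) := by field_simp
      _ ≤ _ := by gcongr; exact le_max_right _ _

theorem component_recursion {P w κ : Matrix (Fin d) (Fin d) ℂ} (hC : Commute C P)
    (hκ : κ = C * κ + P * w) {n : ℕ} (hrec : F n = C * F (n / q) + g n + w) :
    P * F n - κ = C * (P * F (n / q) - κ) + P * g n := by
  have e : P * F n = C * (P * F (n / q)) + P * g n + P * w := by
    rw [hrec, mul_add, mul_add, ← mul_assoc, ← hC.eq, mul_assoc]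
  calc P * F n - κ = C * (P * F (n / q)) + P * g n + P * w - (C * κ + P * w) := by rw [← e, ← hκ]
    _ = _ := by rw [mul_sub]; abel

/-- For `z ≠ 1`, subtracting the fixed point leaves only the forcing from `g`. For `z = 1` one has
`R ≥ 1`, so the constant forcing is harmless, and the term with `ϑ` is itself absorbed: by `R ^
log_q N` if `R > 1`, by the logarithmic factor if `R = 1`. -/
theorem component_isBigO (hq : 2 ≤ q) (hR : 0 < R)
    (h : IsRegularSum q C (1 - A₀) f F g R) (hT : IsUnit T.det) (hTJ : T * C * T⁻¹ = J)
    (hJ : IsJordanForm J) {z : ℂ} (hz : ‖z‖ ≤ R) :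
    (fun N : ℕ => eigenProj T J hT z * F N -
      ((Real.logb q N : ℂ) ^ maxBlock J 1) • thetaPart C T J A₀ z -
      eigenProj T J hT z * constK T J A₀) =O[atTop] (fun N : ℕ => errorScale q J R N) := by
  have hm := sub_pow_mul_eigenProj hT hTJ hJ z
  have hC := commute_eigenProj hT hTJ hJ z
  have hP := eigenProj_mul_self (J := J) hT z
  obtain ⟨c, hc, hg⟩ := exists_bound_add_const hq hR h (eigenProj T J hT z)
  have main : ∀ G e : ℕ → Matrix (Fin d) (Fin d) ℂ,
      (∀ n, 1 ≤ n → G n = C * G (n / q) + e n) →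
      (∃ c, 0 ≤ c ∧ ∀ n, ‖e n‖ ≤ c * R ^ Nat.log q n) →
      (∀ n, eigenProj T J hT z * G n = G n) →
      G =O[atTop] (fun N : ℕ => errorScale q J R N) := by
    intro G e hG he hPG
    have hmG : ∀ n, (C - algebraMap ℂ _ z) ^ maxBlock J z * G n = 0 := fun n => by
      rw [← hPG n, ← mul_assoc, hm, zero_mul]
    rcases hz.lt_or_eq with hlt | heq
    · obtain ⟨c, hc, H⟩ := exists_bound_of_norm_lt hq hR hlt _ G e hG he hmG
      refine IsBigO.trans (IsBigO.of_bound c (Eventually.of_forall fun n => ?_))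
        (isBigO_errorScale hq hR J (Nat.zero_le _))
      rw [pow_zero, mul_one, Real.norm_of_nonneg (by positivity)]
      exact H n
    · obtain ⟨c, hc, H⟩ := exists_bound_of_norm_eq hq hR heq _ G e hG he hmG
      refine IsBigO.trans (IsBigO.of_bound c (Eventually.of_forall fun n => ?_))
        (isBigO_errorScale hq hR J (maxBlock_le_sSup J heq))
      rw [Real.norm_of_nonneg (by positivity), ← mul_assoc]
      exact H n
  by_cases h1 : z = 1
  · subst h1
    rw [eigenProj_one_mul_constK]
    simp only [thetaPart, if_true, sub_zero]
    rw [norm_one] at hz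
    refine IsBigO.sub ?_ ?_
    · refine main (fun N => eigenProj T J hT 1 * F N)
        (fun n => eigenProj T J hT 1 * g n + eigenProj T J hT 1 * (1 - A₀)) (fun n hn => ?_)
        ⟨c + ‖eigenProj T J hT 1 * (1 - A₀)‖, by positivity, fun n => ?_⟩
        (fun n => by rw [← mul_assoc, hP])
      · rw [h.recursion n hn, mul_add, mul_add, ← mul_assoc, ← hC.eq, mul_assoc, add_assoc]
      · refine (norm_add_le _ _).trans ?_
        rw [add_mul]
        refine add_le_add (hg n) (le_mul_of_one_le_right (norm_nonneg _) (one_le_pow₀ hz))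
    · have hlog : (fun N : ℕ => ((Real.logb q N : ℂ) ^ maxBlock J 1) • theta C T J A₀) =O[atTop]
          (fun N : ℕ => ((Nat.log q N : ℝ) + 1) ^ maxBlock J 1) := by
        refine IsBigO.of_bound ‖theta C T J A₀‖ ?_
        filter_upwards [eventually_ge_atTop 1] with N hN
        obtain ⟨h2, h3⟩ := natLog_le_logb_and_lt q N hq hN
        have h4 : 0 ≤ Real.logb q N := (Nat.cast_nonneg _).trans h2
        rw [norm_smul, norm_pow, Complex.norm_real, Real.norm_of_nonneg h4,
          Real.norm_of_nonneg (by positivity), mul_comm]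
        gcongr
      refine hlog.trans ?_
      rcases hz.lt_or_eq with hlt | heq
      · refine (isBigO_natLog_pow hq hlt _).trans ?_
        simpa using isBigO_errorScale hq hR J (Nat.zero_le _)
      · have := isBigO_errorScale hq hR J (maxBlock_le_sSup J (z := 1) (by rw [norm_one, heq]))
        refine this.congr_left fun N => ?_
        rw [← heq, one_pow, one_mul]
  · have hK := eigenProj_mul_constK hT hTJ hJ A₀ h1
    simp only [thetaPart, if_neg h1, smul_zero, sub_zero]
    refine main (fun N => eigenProj T J hT z * F N - eigenProj T J hT z * constK T J A₀)
      (fun n => eigenProj T J hT z * g n)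
      (fun n hn => component_recursion hC hK (h.recursion n hn)) ⟨c, hc, hg⟩
      (fun n => by rw [mul_sub, ← mul_assoc, ← mul_assoc, hP])

theorem component_eventually_eq (hq : 2 ≤ q)
    (hrec : ∀ n, 1 ≤ n → F n = C * F (n / q) + g n + (1 - A₀)) (hg : ∀ᶠ n in atTop, g n = 0)
    (hT : IsUnit T.det) (hTJ : T * C * T⁻¹ = J) (hJ : IsJordanForm J) :
    ∀ᶠ N in atTop, eigenProj T J hT 0 * F N - eigenProj T J hT 0 * constK T J A₀ = 0 := by
  have hm := sub_pow_mul_eigenProj hT hTJ hJ 0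
  have hC := commute_eigenProj hT hTJ hJ 0
  rw [map_zero, sub_zero] at hm
  have hK := eigenProj_mul_constK hT hTJ hJ A₀ (zero_ne_one (α := ℂ))
  refine eventually_eq_zero_of_nilpotent (C := C) hq (maxBlock J 0)
    (fun N => eigenProj T J hT 0 * F N - eigenProj T J hT 0 * constK T J A₀)
    (fun n => eigenProj T J hT 0 * g n)
    (fun n hn => component_recursion hC hK (hrec n hn))
    (hg.mono fun n hn => by rw [hn, mul_zero]) (fun n => ?_)
  rw [← mul_sub, ← mul_assoc, hm, zero_mul]

theorem norm_entry_le (M : Matrix (Fin d) (Fin d) ℂ) (i j : Fin d) : ‖M i j‖ ≤ ‖M‖ := by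
  have h := Matrix.linfty_opNorm_mulVec M (Pi.single j (1 : ℂ))
  rw [Pi.norm_single, norm_one, mul_one, Matrix.mulVec_single_one] at h
  exact (norm_le_pi_norm (M.col j) i).trans h

theorem IsFluctuation.continuous {q : ℕ} (hq : 2 ≤ q) (hR : 0 < R) {r : ℝ} (hr : R < r)
    {Φ : ℕ → ℝ → Matrix (Fin d) (Fin d) ℂ} (hΦ : IsFluctuation q R r Φ) (k : ℕ) :
    Continuous (Φ k) := by
  have hq1 : (1 : ℝ) < q := by exact_mod_cast hq
  have hq0 : (0 : ℝ) < q := by positivity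
  -- Any positive exponent below `log_q (r / R)` would do; half of it is used.
  have hlog : 0 < Real.logb q (r / R) := Real.logb_pos hq1 ((one_lt_div hR).2 hr)
  have hα : R * (q : ℝ) ^ (Real.logb q (r / R) / 2) < r := by
    rw [mul_comm, ← lt_div_iff₀ hR,
      ← Real.lt_logb_iff_rpow_lt hq1 (div_pos (hR.trans hr) hR)]
    linarith
  obtain ⟨c, hc, H⟩ := hΦ.holder k _ (by positivity) hα
  refine continuous_matrix fun i j => continuous_iff_continuousAt.2 fun x => ?_
  rw [ContinuousAt, tendsto_iff_norm_sub_tendsto_zero]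
  have hlim : Tendsto (fun y : ℝ => c * |y - x| ^ (Real.logb q (r / R) / 2)) (nhds x)
      (nhds 0) := by
    have : Continuous (fun y : ℝ => c * |y - x| ^ (Real.logb q (r / R) / 2)) :=
      continuous_const.mul ((continuous_id.sub continuous_const).abs.rpow_const
        fun _ => Or.inr (by positivity))
    convert! this.tendsto x using 2
    rw [sub_self, abs_zero, Real.zero_rpow (by positivity), mul_zero]
  refine squeeze_zero (fun _ => norm_nonneg _) (fun y => ?_) hlim
  exact (norm_entry_le (Φ k y - Φ k x) i j).trans (H y x)

end Components

end RegularSeq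

/-! ### Assembly of the components -/

theorem theorem5p2
    (q d : ℕ) (hq : 2 ≤ q) (hd : 1 ≤ d)
    (A : Fin q → Matrix (Fin d) (Fin d) ℂ)
    -- the matrix sequence `f`
    (f : ℕ → Matrix (Fin d) (Fin d) ℂ)
    (hf0 : f 0 = 1)
    (hf : ∀ (n : ℕ) (r : Fin q), q * n + r ≠ 0 → f (q * n + r) = A r * f n)
    -- the fixed norm on `ℂ^d`
    (p : Seminorm ℂ (Fin d → ℂ)) (hp : ∀ v, p v = 0 → v = 0)
    (R : ℝ) (hR : RegularSeq.IsAdmissibleRadius p A R)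
    -- the choice of a regular matrix `T` that brings `C` to Jordan form `J`
    (T J : Matrix (Fin d) (Fin d) ℂ) (hT : IsUnit T.det)
    (hTJ : T * RegularSeq.sumMat A * T⁻¹ = J) (hJ : RegularSeq.IsJordanForm J) :
    ∃ Φ : ℂ → ℕ → ℝ → Matrix (Fin d) (Fin d) ℂ,
      -- the fluctuations are continuous and `1`-periodic
      (∀ z ∈ spectrum ℂ (RegularSeq.sumMat A), RegularSeq.jointSpectralRadius p A < ‖z‖ →
        ∀ k < RegularSeq.maxBlock J z,
          Continuous (Φ z k) ∧ Function.Periodic (Φ z k) 1) ∧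
      -- the asymptotic expansion of `F(N)`
      (fun N : ℕ => RegularSeq.inducedNorm p
          ((∑ n ∈ Finset.range N, f n) -
            RegularSeq.mainTerms q (RegularSeq.sumMat A) T J (A ⟨0, by omega⟩)
              (RegularSeq.jointSpectralRadius p A) Φ N))
        =O[Filter.atTop] (fun N : ℕ => RegularSeq.errorScale q J R N) ∧
      -- `ϑ = 0` if `1` is not an eigenvalue of `C`
      ((1 : ℂ) ∉ spectrum ℂ (RegularSeq.sumMat A) →
        RegularSeq.theta (RegularSeq.sumMat A) T J (A ⟨0, by omega⟩) = 0) ∧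
      -- the expansion is exact if `C` has no eigenvalue of modulus at most `ρ`
      ((∀ z ∈ spectrum ℂ (RegularSeq.sumMat A), ¬ ‖z‖ ≤ RegularSeq.jointSpectralRadius p A) →
        ∀ N : ℕ, 1 ≤ N →
          (∑ n ∈ Finset.range N, f n) =
            RegularSeq.mainTerms q (RegularSeq.sumMat A) T J (A ⟨0, by omega⟩)
              (RegularSeq.jointSpectralRadius p A) Φ N) ∧
      -- Hölder continuity for `|z| > R`
      (∀ z ∈ spectrum ℂ (RegularSeq.sumMat A), R < ‖z‖ →
        ∀ k < RegularSeq.maxBlock J z,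
          ∀ α : ℝ, 0 < α → α < Real.logb q (‖z‖ / R) →
            ∃ c : ℝ, ∀ x y : ℝ,
              RegularSeq.inducedNorm p (Φ z k x - Φ z k y) ≤ c * |x - y| ^ α) := by
  open RegularSeq Finset Filter Asymptotics in
  classical
  let _ : NormedRing (Matrix (Fin d) (Fin d) ℂ) := Matrix.linftyOpNormedRing
  let _ : NormedAlgebra ℂ (Matrix (Fin d) (Fin d) ℂ) := Matrix.linftyOpNormedAlgebra
  have hq1 : (1 : ℝ) < q := by exact_mod_cast hq
  have hR0 : 0 ≤ R := jointSpectralRadius_nonneg.trans hR.le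
  obtain ⟨l, hl, hword⟩ := hR.exists_word_bound
  obtain ⟨a, ha, hind⟩ := exists_inducedNorm_le_norm hd p hp
  obtain ⟨b, hb, hnorm⟩ := exists_norm_le_inducedNorm hd p hp
  set A₀ := A ⟨0, by omega⟩ with hA₀
  set C := sumMat A with hC
  set F : ℕ → Matrix (Fin d) (Fin d) ℂ := fun N => ∑ n ∈ range N, f n with hF
  set g : ℕ → Matrix (Fin d) (Fin d) ℂ := fun n => partialSum A (n % q) * f (n / q) with hg
  have hspec : ∀ z ∈ spectrum ℂ C, ‖z‖ ≤ q * R := fun z hz =>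
    norm_le_of_mem_spectrum hd hp hR0 hl hword hz
  -- If `R = 0`, the bound `‖z‖ ≤ q * R` leaves no eigenvalue except `0`.
  have hRpos : ∀ z ∈ spectrum ℂ C, R < ‖z‖ → 0 < R := by
    intro z hz h
    rcases hR0.eq_or_lt with h0 | h0
    · have := hspec z hz
      rw [← h0] at this h
      linarith
    · exact h0
  have hreg : 0 < R → IsRegularSum q C (1 - A₀) f F g R := by
    intro h0
    refine isRegularSum_sum_range hq hf0 hf ?_
    obtain ⟨c, hc, H⟩ := exists_bound_of_word_bound hq hd hp hf h0 hl hword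
    refine ⟨b * c, by positivity, fun n => (hnorm _).trans ?_⟩
    rw [mul_assoc]
    exact mul_le_mul_of_nonneg_left (H n) hb
  have hΦ : ∀ z : ℂ, ∃ Φ : ℕ → ℝ → Matrix (Fin d) (Fin d) ℂ, z ∈ spectrum ℂ C → R < ‖z‖ →
      IsFluctuation q R ‖z‖ Φ ∧ ∀ N : ℕ, 1 ≤ N →
      eigenProj T J hT z * F N = ((N : ℂ) ^ (Complex.log z / (Real.log q : ℂ))) •
        (∑ k ∈ range (maxBlock J z),
          ((Real.logb q N : ℂ) ^ k) • Φ k (Int.fract (Real.logb q N))) +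
        ((Real.logb q N : ℂ) ^ maxBlock J 1) • thetaPart C T J A₀ z +
        eigenProj T J hT z * constK T J A₀ := by
    intro z
    by_cases h : z ∈ spectrum ℂ C ∧ R < ‖z‖
    · have h0 := hRpos z h.1 h.2
      obtain ⟨Φ, H⟩ := exists_component_expansion hq h0 (hreg h0) hT hTJ hJ h.2 (hspec z h.1)
      exact ⟨Φ, fun _ _ => H⟩
    · exact ⟨fun _ _ => 0, fun h1 h2 => absurd ⟨h1, h2⟩ h⟩
  choose Φ hΦ using hΦ
  have htheta : (1 : ℂ) ∉ spectrum ℂ C → theta C T J A₀ = 0 := fun h =>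
    theta_eq_zero_of_eigenProj hT A₀ (eigenProj_eq_zero hT hTJ hJ h)
  set S : Finset ℂ := (Matrix.finite_spectrum C).toFinset with hS
  have hmemS : ∀ z, z ∈ S ↔ z ∈ spectrum ℂ C := fun z => Set.Finite.mem_toFinset _
  have hdiag : ∀ j, J j j ∈ S := fun j => (hmemS _).2 (mem_spectrum_of_diag hT hTJ hJ j)
  have hlarge : largeEigenvalues C (jointSpectralRadius p A) = S.filter fun z => R < ‖z‖ := by
    ext z
    rw [largeEigenvalues, mem_filter, mem_filter]
    exact and_congr_right fun hz => hR.lt_iff ((hmemS z).1 hz)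
  have hthetasum : ∑ z ∈ S, thetaPart C T J A₀ z = theta C T J A₀ := by
    simp only [thetaPart]
    rw [sum_ite_eq']
    split_ifs with h
    · rfl
    · exact (htheta fun h' => h ((hmemS 1).2 h')).symm
  -- The projections sum to `1` and the expansions for `|z| > R` are exact, so the whole error comes
  -- from the eigenvalues with `|z| ≤ R`.
  have hdecomp : ∀ N : ℕ, 1 ≤ N →
      F N - mainTerms q C T J A₀ (jointSpectralRadius p A) Φ N =
      ∑ z ∈ S.filter (fun z => ¬ R < ‖z‖), (eigenProj T J hT z * F N -
        ((Real.logb q N : ℂ) ^ maxBlock J 1) • thetaPart C T J A₀ z -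
        eigenProj T J hT z * constK T J A₀) := by
    intro N hN
    have e1 : F N = ∑ z ∈ S, eigenProj T J hT z * F N := by
      rw [← sum_mul, sum_eigenProj hT hdiag, one_mul]
    have e2 : constK T J A₀ = ∑ z ∈ S, eigenProj T J hT z * constK T J A₀ := by
      rw [← sum_mul, sum_eigenProj hT hdiag, one_mul]
    have e3 : ((Real.logb q N : ℂ) ^ maxBlock J 1) • theta C T J A₀ =
        ∑ z ∈ S, ((Real.logb q N : ℂ) ^ maxBlock J 1) • thetaPart C T J A₀ z := by
      rw [← smul_sum, hthetasum]
    have e4 : F N - ((Real.logb q N : ℂ) ^ maxBlock J 1) • theta C T J A₀ - constK T J A₀ =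
        ∑ z ∈ S, (eigenProj T J hT z * F N -
        ((Real.logb q N : ℂ) ^ maxBlock J 1) • thetaPart C T J A₀ z -
        eigenProj T J hT z * constK T J A₀) := by
      rw [sum_sub_distrib, sum_sub_distrib, ← e1, ← e2, ← e3]
    rw [← sum_filter_add_sum_filter_not S (fun z => R < ‖z‖)] at e4
    have e5 : ∑ z ∈ S.filter (fun z => R < ‖z‖), (eigenProj T J hT z * F N -
        ((Real.logb q N : ℂ) ^ maxBlock J 1) • thetaPart C T J A₀ z -
        eigenProj T J hT z * constK T J A₀) =
        ∑ z ∈ S.filter (fun z => R < ‖z‖),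
        ((N : ℂ) ^ (Complex.log z / (Real.log q : ℂ))) • (∑ k ∈ range (maxBlock J z),
          ((Real.logb q N : ℂ) ^ k) • Φ z k (Int.fract (Real.logb q N))) := by
      refine sum_congr rfl fun z hz => ?_
      rw [mem_filter] at hz
      rw [(hΦ z ((hmemS z).1 hz.1) hz.2).2 N hN]
      abel
    rw [e5] at e4
    rw [mainTerms, hlarge, ← sub_eq_iff_eq_add'.2 e4]
    abel
  refine ⟨Φ, fun z hz hρ k _ => ?_, ?_, htheta, fun hno N hN => ?_, fun z hz hRz k _ α hα hαz => ?_⟩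
  · have hRz := (hR.lt_iff hz).1 hρ
    have h1 := (hΦ z hz hRz).1
    exact ⟨h1.continuous hq (hRpos z hz hRz) hRz k, h1.periodic k⟩
  · have hO : (fun N : ℕ => F N - mainTerms q C T J A₀ (jointSpectralRadius p A) Φ N) =O[atTop]
        (fun N : ℕ => errorScale q J R N) := by
      have hsum : (fun N : ℕ => ∑ z ∈ S.filter (fun z => ¬ R < ‖z‖), (eigenProj T J hT z * F N -
          ((Real.logb q N : ℂ) ^ maxBlock J 1) • thetaPart C T J A₀ z -
          eigenProj T J hT z * constK T J A₀)) =O[atTop]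
          (fun N : ℕ => errorScale q J R N) := by
        refine IsBigO.fun_sum fun z hz => ?_
        rw [mem_filter, not_lt] at hz
        rcases hR0.eq_or_lt with h0 | h0
        -- For `R = 0` the error scale is identically `0`, so eventual vanishing is required; it
        -- holds because `f` is eventually zero and `C` is nilpotent on this component.
        · have hz0 : z = 0 := by
            rw [← norm_le_zero_iff, h0]; exact hz.2
          subst hz0
          rw [← h0] at hword
          have hf' := eventually_eq_zero_of_word_bound hq hd hp hf hl hword
          have hg' : ∀ᶠ n in atTop, g n = 0 :=
            ((Nat.tendsto_div_const_atTop (by omega : q ≠ 0)).eventually hf').mono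
              fun n hn => by simp only [hg]; rw [hn, mul_zero]
          have := component_eventually_eq (A₀ := A₀) (F := F) hq
            (fun n hn => sum_range_recursion hq hf0 hf n hn) hg' hT hTJ hJ
          refine IsBigO.of_bound 0 (this.mono fun N hN => ?_)
          simp only [thetaPart, zero_ne_one, if_false, smul_zero, sub_zero]
          rw [hN, norm_zero, zero_mul]
        · exact component_isBigO hq h0 (hreg h0) hT hTJ hJ hz.2
      refine hsum.congr' ?_ EventuallyEq.rfl
      filter_upwards [eventually_ge_atTop 1] with N hN
      exact (hdecomp N hN).symm
    refine IsBigO.trans (IsBigO.of_bound a (Eventually.of_forall fun N => ?_)) hO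
    rw [Real.norm_of_nonneg (inducedNorm_nonneg _ _)]
    exact hind _
  · rw [← sub_eq_zero]
    refine (hdecomp N hN).trans ?_
    -- With every eigenvalue larger than `ρ` in modulus, hence larger than `R`, the error is an
    -- empty sum.
    rw [filter_eq_empty_iff.2, sum_empty]
    intro z hz
    rw [not_not]
    exact (hR.lt_iff ((hmemS z).1 hz)).1 (not_le.1 (hno z ((hmemS z).1 hz)))
  · have h0 := hRpos z hz hRz
    rw [Real.lt_logb_iff_rpow_lt hq1 (div_pos (h0.trans hRz) h0), lt_div_iff₀ h0, mul_comm] at hαz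
    obtain ⟨c, hc, H⟩ := (hΦ z hz hRz).1.holder k α hα hαz
    refine ⟨a * c, fun x y => (hind _).trans ?_⟩
    rw [mul_assoc]
    exact mul_le_mul_of_nonneg_left (H x y) ha
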